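/- Let $n\ge 1$, $s\ge 1$ and $k>0$ be integers. For a compact $n$-dimensional Riemannian manifold $(\Omega,g)$ with smooth boundary (not necessarily connected), let $\lambda^N_0(\Omega,g)\le\lambda^N_1(\Omega,g)\le\dots$ be the Neumann eigenvalues of the Laplace–Beltrami operator, repeated according to multiplicity and indexed from $0$, let $[g]=\{e^{2\omega}g : \omega\in C^\infty(\Omega)\}$ be the conformal class of $g$, and put $$\Lambda^N_k(\Omega,[g])=\sup_{\tilde g\in[g]}\lambda^N_k(\Omega,\tilde g)\,\operatorname{Vol}(\Omega,\tilde g)^{2/n}\in[0,\infty].$$ If $(\Omega,g)=\bigsqcup_{i=1}^s(\Omega_i,g_i)$ is a disjoint union of non-empty connected compact $n$-dimensional Riemannian manifolds with smooth boundary, then $$\Lambda^N_k(\Omega,[g])^{n/2}=\max_{k_1+\dots+k_s=k,\ k_i>0}\ \sum_{i=1}^s\Lambda^N_{k_i}(\Omega_i,[g_i])^{n/2},$$ where $k_1,\dots,k_s$ are integers and the maximum over the empty set (the case $k<s$) is $0$. Similarly, for a closed $n$-dimensional Riemannian manifold $(M,g)$ let $\Lambda_k(M,[g])$ be defined in the same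 way from the eigenvalues $\lambda_0(M,\cdot)\le\lambda_1(M,\cdot)\le\dots$ of the Laplace–Beltrami operator. If $(M,g)=\bigsqcup_{i=1}^s(M_i,g_i)$ is a disjoint union of non-empty connected closed $n$-dimensional Riemannian manifolds, then $$\Lambda_k(M,[g])^{n/2}=\max_{k_1+\dots+k_s=k,\ k_i>0}\ \sum_{i=1}^s\Lambda_{k_i}(M_i,[g_i])^{n/2},$$ with the same convention for $k<s$. -/

import Mathlib

open scoped Manifold ContDiff ENNReal NNReal Topology

noncomputable section

namespace ConformalSpectrum

/-! ### Disjoint unions of manifolds -/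

section DisjointUnion

variable {ι : Type*} {H : Type*} [TopologicalSpace H] [Nonempty H]
  {M : ι → Type*} [∀ i, TopologicalSpace (M i)] [∀ i, ChartedSpace H (M i)]

/-- The disjoint union `⊔ᵢ Mᵢ` as a charted space: its charts are the charts of the `Mᵢ`. -/
instance sigmaChartedSpace : ChartedSpace H (Σ i, M i) where
  atlas := {e | ∃ i, ∃ f ∈ atlas H (M i),
    e = f.lift_openEmbedding (Topology.IsOpenEmbedding.sigmaMk (i := i))}
  chartAt p := (chartAt H p.2).lift_openEmbedding (Topology.IsOpenEmbedding.sigmaMk (i := p.1))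
  mem_chart_source p := ⟨p.2, mem_chart_source H p.2, rfl⟩
  chart_mem_atlas p := ⟨p.1, chartAt H p.2, chart_mem_atlas H p.2, rfl⟩

variable {E : Type*} [NormedAddCommGroup E] [NormedSpace ℝ E]

instance sigmaIsManifold (I : ModelWithCorners ℝ E H) (r : WithTop ℕ∞)
    [∀ i, IsManifold I r (M i)] : IsManifold I r (Σ i, M i) where
  compatible {e e'} he he' := by
    obtain ⟨i, f, hf, rfl⟩ := he
    obtain ⟨j, f', hf', rfl⟩ := he'
    by_cases hij : i = j
    · subst hij
      rw [f.lift_openEmbedding_trans f']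
      exact (contDiffGroupoid r I).compatible hf hf'
    · apply ContDiffGroupoid.mem_of_source_eq_empty
      ext x
      refine ⟨fun ⟨_, y, _, hy⟩ ↦ hij ?_, fun hx ↦ hx.elim⟩
      exact (congrArg Sigma.fst hy).symm

end DisjointUnion

/-! ### Riemannian metrics -/

section Metric

variable {n : ℕ} {H : Type*} [TopologicalSpace H]

/-- Smooth Riemannian metrics on a smooth `n`-dimensional manifold `M` (possibly with boundary). -/
abbrev SmoothMetric (I : ModelWithCorners ℝ (EuclideanSpace ℝ (Fin n)) H) (M : Type*)
    [TopologicalSpace M] [ChartedSpace H M] [IsManifold I ∞ M] :=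
  Bundle.ContMDiffRiemannianMetric I ∞ (EuclideanSpace ℝ (Fin n))
    (fun x : M ↦ TangentSpace I x)

variable {I : ModelWithCorners ℝ (EuclideanSpace ℝ (Fin n)) H}

section Sigma

variable [Nonempty H] {ι : Type*} {M : ι → Type*} [∀ i, TopologicalSpace (M i)]
  [∀ i, ChartedSpace H (M i)]

lemma extChartAt_sigma_apply (i : ι) (x y : M i) :
    extChartAt I (⟨i, x⟩ : Σ i, M i) ⟨i, y⟩ = extChartAt I x y := by
  change I ((chartAt H (⟨i, x⟩ : Σ i, M i)) ⟨i, y⟩) = I (chartAt H x y)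
  congr 1
  exact (chartAt H x).lift_openEmbedding_apply (Topology.IsOpenEmbedding.sigmaMk (i := i))

lemma extChartAt_sigma_symm_apply (i : ι) (x : M i) (z : EuclideanSpace ℝ (Fin n)) :
    (extChartAt I (⟨i, x⟩ : Σ i, M i)).symm z = ⟨i, (extChartAt I x).symm z⟩ := rfl

lemma contMDiffAt_sigma {F : Type*} [NormedAddCommGroup F] [NormedSpace ℝ F] {i : ι} {x : M i}
    {f : (Σ i, M i) → F} (h : ContMDiffAt I 𝓘(ℝ, F) ∞ (fun y ↦ f ⟨i, y⟩) x) :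
    ContMDiffAt I 𝓘(ℝ, F) ∞ f ⟨i, x⟩ := by
  rw [contMDiffAt_iff] at h ⊢
  refine ⟨?_, ?_⟩
  · rw [ContinuousAt, Sigma.nhds_mk, Filter.tendsto_map'_iff]
    exact h.1
  · rw [extChartAt_sigma_apply]
    exact h.2

variable [∀ i, IsManifold I ∞ (M i)]

lemma tangentCoordChange_sigma (i : ι) (x y z : M i) :
    tangentCoordChange I (⟨i, x⟩ : Σ i, M i) ⟨i, y⟩ ⟨i, z⟩ = tangentCoordChange I x y z := by
  rw [tangentCoordChange_def, tangentCoordChange_def, extChartAt_sigma_apply]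
  congr 1
  funext w
  exact extChartAt_sigma_apply i y _

/-- The metric on `⊔ᵢ Mᵢ` that restricts to `gᵢ` on `Mᵢ`. -/
def sigmaMetric (g : ∀ i, SmoothMetric I (M i)) : SmoothMetric I (Σ i, M i) where
  inner p := (g p.1).inner p.2
  symm p := (g p.1).symm p.2
  pos p := (g p.1).pos p.2
  isVonNBounded p := (g p.1).isVonNBounded p.2
  contMDiff := by
    rintro ⟨i, x⟩
    have hx := (g i).contMDiff x
    rw [contMDiffAt_hom_bundle] at hx ⊢
    refine ⟨contMDiffAt_id, contMDiffAt_sigma (hx.2.congr_of_eventuallyEq ?_)⟩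
    filter_upwards [(chartAt H x).open_source.mem_nhds (mem_chart_source H x)] with y hy
    have hy' : (⟨i, y⟩ : Σ i, M i) ∈ (chartAt H (⟨i, x⟩ : Σ i, M i)).source := ⟨y, hy, rfl⟩
    have key (v : EuclideanSpace ℝ (Fin n)) :
        (trivializationAt (EuclideanSpace ℝ (Fin n)) (TangentSpace I)
          (⟨i, x⟩ : Σ i, M i)).symm ⟨i, y⟩ v =
        (trivializationAt (EuclideanSpace ℝ (Fin n)) (TangentSpace I) x).symm y v := by
      have h1 := congrArg (fun T ↦ T v)
        (TangentBundle.symmL_trivializationAt_eq_core (I := I) hy')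
      have h2 := congrArg (fun T ↦ T v)
        (TangentBundle.symmL_trivializationAt_eq_core (I := I) hy)
      have h3 := congrArg (fun T ↦ T v) (tangentCoordChange_sigma (I := I) i x y y)
      have h4 := (h1.trans h3).trans h2.symm
      rwa [Bundle.Trivialization.symmL_apply _ hy', Bundle.Trivialization.symmL_apply _ hy] at h4
    ext v w
    refine (inCoordinates_apply_eq₂ (E₁ := fun p : Σ i, M i ↦ TangentSpace I p)
      (E₂ := fun p : Σ i, M i ↦ TangentSpace I p) (E₃ := Bundle.Trivial (Σ i, M i) ℝ)
      hy' hy' (Set.mem_univ _)).trans (Eq.trans ?_ (inCoordinates_apply_eq₂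
        (E₁ := fun p : M i ↦ TangentSpace I p) (E₂ := fun p : M i ↦ TangentSpace I p)
        (E₃ := Bundle.Trivial (M i) ℝ) hy hy (Set.mem_univ _)).symm)
    rw [key v, key w]
    rfl

/-- The inclusion `Mᵢ → ⊔ⱼ Mⱼ` pulls the metric of the disjoint union back to `gᵢ`. -/
lemma sigmaMetric_pullback (g : ∀ i, SmoothMetric I (M i)) (i : ι) (x : M i) (v w : TangentSpace I x) :
    (sigmaMetric g).inner ⟨i, x⟩ (mfderiv I I (Sigma.mk i) x v) (mfderiv I I (Sigma.mk i) x w) =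
      (g i).inner x v w := by
  have h : HasMFDerivAt I I (Sigma.mk i) x
      (ContinuousLinearMap.id ℝ (EuclideanSpace ℝ (Fin n))) := by
    refine ⟨continuous_sigmaMk.continuousAt, ?_⟩
    refine (hasFDerivWithinAt_id _ _).congr_of_eventuallyEq ?_ ?_
    · filter_upwards [extChartAt_target_mem_nhdsWithin (I := I) x] with y hy
      exact (extChartAt_sigma_apply i x _).trans ((extChartAt I x).right_inv hy)
    · exact (extChartAt_sigma_apply i x _).trans
        ((extChartAt I x).right_inv (mem_extChartAt_target x))
  rw [h.mfderiv]
  rfl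

end Sigma

variable {M : Type*} [TopologicalSpace M] [ChartedSpace H M] [IsManifold I ∞ M]

/-- The conformal class `[g] = {e^{2f} g | f ∈ C^∞(M)}`. -/
def conformalClass (g : SmoothMetric I M) : Set (SmoothMetric I M) :=
  {h | ∃ f : C^∞⟮I, M; 𝓘(ℝ, ℝ), ℝ⟯, ∀ (x : M) (v w : TangentSpace I x),
    h.inner x v w = Real.exp (2 * f x) * g.inner x v w}

/-! ### Riemannian volume -/

/-- The standard basis of `T_x M = ℝⁿ`: the coordinate frame at `x` of the chart at `x`. -/
def frame (I : ModelWithCorners ℝ (EuclideanSpace ℝ (Fin n)) H) (x : M) :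
    Module.Basis (Fin n) ℝ (TangentSpace I x) :=
  (EuclideanSpace.basisFun (Fin n) ℝ).toBasis

/-- The coordinate vector field `∂ᵢ` of the chart at `c`, at the point with coordinates `y`. -/
def coordVector (I : ModelWithCorners ℝ (EuclideanSpace ℝ (Fin n)) H) (c : M)
    (y : EuclideanSpace ℝ (Fin n)) (i : Fin n) : TangentSpace I ((extChartAt I c).symm y) :=
  mfderivWithin 𝓘(ℝ, EuclideanSpace ℝ (Fin n)) I (extChartAt I c).symm (Set.range I) y
    (frame 𝓘(ℝ, EuclideanSpace ℝ (Fin n)) y i)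

/-- The matrix `(g(∂ᵢ, ∂ⱼ))ᵢⱼ` of the metric in the chart at `c`, as a function of the
coordinates `y`. -/
def metricCoeff (g : SmoothMetric I M) (c : M) (y : EuclideanSpace ℝ (Fin n)) :
    Matrix (Fin n) (Fin n) ℝ :=
  Matrix.of fun i j ↦
    g.inner ((extChartAt I c).symm y) (coordVector I c y i) (coordVector I c y j)

/-- The volume measure of `g` on the domain of the chart at `c`: the measure `√(det gᵢⱼ) dy` on the
range of the chart, carried to `M`. It gives mass zero to the complement of the chart domain. -/
def chartVolume (g : SmoothMetric I M) (c : M) : @MeasureTheory.Measure M (borel M) :=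
  @MeasureTheory.Measure.map _ M _ (borel M) (extChartAt I c).symm
    ((MeasureTheory.volume.restrict (extChartAt I c).target).withDensity
      fun y ↦ ENNReal.ofReal (Real.sqrt (metricCoeff g c y).det))

/-- The Riemannian volume measure `dv_g` on the Borel sets of `M`: the smallest measure that
dominates the volume measures of all chart domains. As the latter agree on overlaps, this is
the measure given by `√(det gᵢⱼ) dy` in every chart. -/
def volumeMeasure (g : SmoothMetric I M) : @MeasureTheory.Measure M (borel M) :=
  ⨆ c : M, chartVolume g c

/-- `Vol(M, g)`. -/
def vol (g : SmoothMetric I M) : ℝ≥0∞ := volumeMeasure g Set.univ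

/-! ### Neumann eigenvalues -/

/-- The matrix `(gᵢⱼ)` of `g_x` in the basis `frame I x`. -/
def gramMatrix (g : SmoothMetric I M) (x : M) : Matrix (Fin n) (Fin n) ℝ :=
  Matrix.of fun i j ↦ g.inner x (frame I x i) (frame I x j)

/-- The differential `du` at `x`. -/
def differential (I : ModelWithCorners ℝ (EuclideanSpace ℝ (Fin n)) H) (u : M → ℝ) (x : M) :
    TangentSpace I x →L[ℝ] ℝ :=
  mfderiv I 𝓘(ℝ, ℝ) u x

/-- The gradient `∇u = ∑ᵢⱼ gⁱʲ ∂ⱼu ∂ᵢ` of a function at `x`. -/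
def grad (g : SmoothMetric I M) (u : M → ℝ) (x : M) : TangentSpace I x :=
  ∑ i, ∑ j, ((gramMatrix g x)⁻¹ i j * differential I u x (frame I x j)) • frame I x i

lemma isUnit_det_gramMatrix (g : SmoothMetric I M) (x : M) : IsUnit (gramMatrix g x).det := by
  rw [isUnit_iff_ne_zero]
  intro h0
  obtain ⟨a, ha, hGa⟩ := Matrix.exists_mulVec_eq_zero_iff.2 h0
  set v : TangentSpace I x := ∑ i, a i • frame I x i with hv
  have hv0 : v ≠ 0 := fun h ↦ ha <| funext fun i ↦
    (Fintype.linearIndependent_iff.1 (frame I x).linearIndependent a h i)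
  have hzero (i : Fin n) : g.inner x (frame I x i) v = 0 := by
    have := congrFun hGa i
    simpa [hv, Matrix.mulVec, dotProduct, gramMatrix, mul_comm] using this
  refine (g.pos x v hv0).ne' ?_
  have : g.inner x v v = ∑ i, a i * g.inner x (frame I x i) v := by
    conv_lhs => rw [g.symm, hv, map_sum]
    refine Finset.sum_congr rfl fun i _ ↦ ?_
    rw [map_smul, smul_eq_mul, g.symm]
  rw [this]
  simp [hzero]

/-- The gradient represents the differential: `g(∇u, v) = du(v)`. -/
lemma inner_grad (g : SmoothMetric I M) (u : M → ℝ) (x : M) (v : TangentSpace I x) :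
    g.inner x (grad g u x) v = differential I u x v := by
  set D := differential I u x with hD
  have hG : gramMatrix g x * (gramMatrix g x)⁻¹ = 1 :=
    Matrix.mul_nonsing_inv _ (isUnit_det_gramMatrix g x)
  have key : (g.inner x (grad g u x)).toLinearMap = D.toLinearMap := by
    refine (frame I x).ext fun l ↦ ?_
    change g.inner x (grad g u x) (frame I x l) = D (frame I x l)
    rw [g.symm, grad, map_sum]
    calc ∑ i, g.inner x (frame I x l)
          (∑ j, ((gramMatrix g x)⁻¹ i j * D (frame I x j)) • frame I x i)
        = ∑ i, ∑ j, gramMatrix g x l i * (gramMatrix g x)⁻¹ i j * D (frame I x j) := by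
          refine Finset.sum_congr rfl fun i _ ↦ ?_
          rw [map_sum]
          refine Finset.sum_congr rfl fun j _ ↦ ?_
          rw [map_smul, smul_eq_mul, gramMatrix, Matrix.of_apply]
          ring
      _ = ∑ j, (gramMatrix g x * (gramMatrix g x)⁻¹) l j * D (frame I x j) := by
          rw [Finset.sum_comm]
          simp only [Matrix.mul_apply, Finset.sum_mul]
      _ = D (frame I x l) := by
          rw [hG]
          simp [Matrix.one_apply]
  exact congrArg (fun T : TangentSpace I x →ₗ[ℝ] ℝ ↦ T v) key

/-- `u ∈ C^∞(M)` solves the Neumann eigenvalue problem `Δu = μu` in `M`, `∂u/∂ν = 0` on `∂M`, in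
variational form: `∫ ⟨∇u, ∇φ⟩ dv_g = μ ∫ u φ dv_g` for all `φ ∈ C^∞(M)`. (Functions in `C^∞(M)` are
smooth up to the boundary. If `∂M = ∅`, this is `Δu = μu`.) -/
def IsNeumannSolution (g : SmoothMetric I M) (μ : ℝ) (u : C^∞⟮I, M; 𝓘(ℝ, ℝ), ℝ⟯) : Prop :=
  ∀ φ : C^∞⟮I, M; 𝓘(ℝ, ℝ), ℝ⟯,
    ∫ x, g.inner x (grad g u x) (grad g φ x) ∂(volumeMeasure g) =
      μ * ∫ x, u x * φ x ∂(volumeMeasure g)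

/-- The span of all eigenfunctions with eigenvalue at most `L`. Its dimension is the number of
eigenvalues in `[0, L]`, counted with multiplicity. -/
def spectralSpace (g : SmoothMetric I M) (L : ℝ) : Submodule ℝ C^∞⟮I, M; 𝓘(ℝ, ℝ), ℝ⟯ :=
  Submodule.span ℝ {u | ∃ μ ≤ L, IsNeumannSolution g μ u}

/-- The `k`-th Neumann eigenvalue `λ_k(M, g)`, where `0 = λ_0 ≤ λ_1 ≤ λ_2 ≤ …` are the eigenvalues
repeated according to multiplicity: the least `L` such that at least `k + 1` eigenvalues, counted
with multiplicity, are at most `L`. If `∂M = ∅`, it is the `k`-th eigenvalue of the Laplacian. -/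
def eigenvalue (g : SmoothMetric I M) (k : ℕ) : ℝ≥0∞ :=
  ⨅ (L : ℝ≥0) (_ : ((k + 1 : ℕ) : Cardinal) ≤ Module.rank ℝ (spectralSpace g L)), (L : ℝ≥0∞)

/-- The normalized eigenvalue `λ_k(M, g) Vol(M, g)^{2/n}`. -/
def normalizedEigenvalue (g : SmoothMetric I M) (k : ℕ) : ℝ≥0∞ :=
  eigenvalue g k * vol g ^ (2 / n : ℝ)

/-- The conformal eigenvalue `Λ_k(M, [g])`: the supremum of the normalized eigenvalue over `[g]`,
taken in `[0, ∞]`. -/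
def conformalEigenvalue (g : SmoothMetric I M) (k : ℕ) : ℝ≥0∞ :=
  ⨆ h ∈ conformalClass g, normalizedEigenvalue h k

end Metric

end ConformalSpectrum

end

open ConformalSpectrum

/-!
Rescaling metrics shows that `Λ_k ^ (n / 2)` is the supremum of the volumes of those `h` in the
conformal class with `1 ≤ λ_k(h)`, that is, with at most `k` eigenvalues below `1`. On a disjoint
union the metrics of a conformal class are independent choices on the pieces, and both the volume
and the number of eigenvalues below `1` are sums over the pieces. Each piece contributes at least
one eigenvalue below `1`, because of the constants; so a metric on the union with at most `k` such
eigenvalues distributes `k` into positive parts, and metrics on the pieces glue back.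

Connectedness enters only through `0 < λ_1`, which guarantees that for `k_i > 0` the supremum is
over a nonempty family. To prove it, integrate derivatives along segments: this gives a Poincaré
inequality on small balls or half balls of a chart, which are convex. Compactness and connectedness
chain these into a Poincaré inequality on the whole manifold, with differences `w x - w y` in place
of `w` minus its mean so that overlapping neighbourhoods combine directly.
-/

noncomputable section

namespace ConformalSpectrum

open MeasureTheory Set

section Oscillation

variable {X : Type*} {_ : MeasurableSpace X} (μ : Measure X)

/-- The oscillation integral `∫_U ∫_V |w x - w y|²` of a function over two sets. For `U = V = X` it
is `2 Vol(X)²` times the variance of `w`. -/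
def oscillation (w : X → ℝ) (U V : Set X) : ℝ≥0∞ :=
  ∫⁻ x in U, ∫⁻ y in V, ‖w x - w y‖ₑ ^ 2 ∂μ ∂μ

variable {w : X → ℝ} {U U' V V' W : Set X}

lemma oscillation_mono (hU : U ⊆ U') (hV : V ⊆ V') :
    oscillation μ w U V ≤ oscillation μ w U' V' :=
  (lintegral_mono fun _ ↦ lintegral_mono_set hV).trans (lintegral_mono_set hU)

lemma measurable_setLIntegral_enorm_sub_sq [SFinite μ] (hw : Measurable w) (V : Set X) :
    Measurable fun x ↦ ∫⁻ y in V, ‖w x - w y‖ₑ ^ 2 ∂μ :=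
  Measurable.lintegral_prod_right' (f := fun p : X × X ↦ ‖w p.1 - w p.2‖ₑ ^ 2) (by fun_prop)

lemma oscillation_union_le [SFinite μ] (hw : Measurable w) :
    oscillation μ w U (V ∪ V') ≤ oscillation μ w U V + oscillation μ w U V' := by
  unfold oscillation
  rw [← lintegral_add_left (measurable_setLIntegral_enorm_sub_sq μ hw V)]
  exact lintegral_mono fun _ ↦ lintegral_union_le _ _ _

lemma oscillation_comm [SFinite μ] (hw : Measurable w) (U V : Set X) :
    oscillation μ w U V = oscillation μ w V U := by
  unfold oscillation
  rw [lintegral_lintegral_swap (by fun_prop)]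
  simp_rw [enorm_sub_rev]

lemma measure_mul_enorm_sub_sq_le (hw : Measurable w) (V : Set X) (x z : X) :
    μ V * ‖w x - w z‖ₑ ^ 2 ≤
      2 * (∫⁻ y in V, ‖w x - w y‖ₑ ^ 2 ∂μ + ∫⁻ y in V, ‖w z - w y‖ₑ ^ 2 ∂μ) := by
  have hsq (y : X) : ‖w x - w z‖ₑ ^ 2 ≤ 2 * (‖w x - w y‖ₑ ^ 2 + ‖w z - w y‖ₑ ^ 2) :=
    calc ‖w x - w z‖ₑ ^ 2 = ‖(w x - w y) - (w z - w y)‖ₑ ^ 2 := by congr 2; ring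
      _ ≤ (‖w x - w y‖ₑ + ‖w z - w y‖ₑ) ^ 2 := by gcongr; exact enorm_sub_le
      _ ≤ 2 * (‖w x - w y‖ₑ ^ 2 + ‖w z - w y‖ₑ ^ 2) := by
        have h := ENNReal.rpow_add_le_mul_rpow_add_rpow ‖w x - w y‖ₑ ‖w z - w y‖ₑ one_le_two
        norm_num at h
        exact h
  calc μ V * ‖w x - w z‖ₑ ^ 2 = ∫⁻ _ in V, ‖w x - w z‖ₑ ^ 2 ∂μ := by
        rw [setLIntegral_const, mul_comm]
    _ ≤ ∫⁻ y in V, 2 * (‖w x - w y‖ₑ ^ 2 + ‖w z - w y‖ₑ ^ 2) ∂μ := lintegral_mono hsq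
    _ = _ := by rw [lintegral_const_mul _ (by fun_prop), lintegral_add_left (by fun_prop)]

lemma measure_mul_oscillation_le [SFinite μ] (hw : Measurable w) (U V W : Set X) :
    μ V * oscillation μ w U W ≤
      2 * (μ W * oscillation μ w U V + μ U * oscillation μ w W V) := by
  have hm := measurable_setLIntegral_enorm_sub_sq μ hw
  set F : X → ℝ≥0∞ := fun x ↦ ∫⁻ y in V, ‖w x - w y‖ₑ ^ 2 ∂μ
  calc μ V * oscillation μ w U W
      = ∫⁻ x in U, ∫⁻ z in W, μ V * ‖w x - w z‖ₑ ^ 2 ∂μ ∂μ := by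
        rw [oscillation, ← lintegral_const_mul _ (hm W)]
        exact lintegral_congr fun x ↦ (lintegral_const_mul _ (by fun_prop)).symm
    _ ≤ ∫⁻ x in U, ∫⁻ z in W, 2 * (F x + F z) ∂μ ∂μ :=
        lintegral_mono fun x ↦ lintegral_mono fun z ↦ measure_mul_enorm_sub_sq_le μ hw V x z
    _ = ∫⁻ x in U, 2 * (μ W * F x + ∫⁻ z in W, F z ∂μ) ∂μ := by
        refine lintegral_congr fun x ↦ ?_
        rw [lintegral_const_mul _ ((hm V).const_add _), lintegral_add_left measurable_const,
          setLIntegral_const, mul_comm (F x)]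
    _ = 2 * (μ W * ∫⁻ x in U, F x ∂μ + μ U * ∫⁻ z in W, F z ∂μ) := by
        rw [lintegral_const_mul _ (((hm V).const_mul _).add_const _),
          lintegral_add_left ((hm V).const_mul _), lintegral_const_mul _ (hm V),
          setLIntegral_const, mul_comm (μ U)]

/-- The functions `u i` satisfy a Poincaré inequality on `U × V` whose constant does not depend on
`i`, with `D i` in the role of the Dirichlet energy of `u i`. -/
def HasPoincareBound {ι : Type*} (u : ι → X → ℝ) (D : ι → ℝ≥0∞) (U V : Set X) : Prop :=
  ∃ C : ℝ≥0, ∀ i, oscillation μ (u i) U V ≤ C * D i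

namespace HasPoincareBound

variable {μ} {ι : Type*} {u : ι → X → ℝ} {D : ι → ℝ≥0∞}

lemma mono (h : HasPoincareBound μ u D U V) (hU : U' ⊆ U) (hV : V' ⊆ V) :
    HasPoincareBound μ u D U' V' :=
  let ⟨C, hC⟩ := h
  ⟨C, fun i ↦ (oscillation_mono μ hU hV).trans (hC i)⟩

lemma symm [SFinite μ] (hu : ∀ i, Measurable (u i)) (h : HasPoincareBound μ u D U V) :
    HasPoincareBound μ u D V U :=
  let ⟨C, hC⟩ := h
  ⟨C, fun i ↦ (oscillation_comm μ (hu i) V U).trans_le (hC i)⟩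

lemma union [SFinite μ] (hu : ∀ i, Measurable (u i)) (h : HasPoincareBound μ u D U V)
    (h' : HasPoincareBound μ u D U V') : HasPoincareBound μ u D U (V ∪ V') := by
  obtain ⟨C, hC⟩ := h
  obtain ⟨C', hC'⟩ := h'
  refine ⟨C + C', fun i ↦ (oscillation_union_le μ (hu i)).trans ?_⟩
  rw [ENNReal.coe_add, add_mul]
  exact add_le_add (hC i) (hC' i)

lemma trans [IsFiniteMeasure μ] (hu : ∀ i, Measurable (u i)) (hV : μ V ≠ 0)
    (h : HasPoincareBound μ u D U V) (h' : HasPoincareBound μ u D V W) :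
    HasPoincareBound μ u D U W := by
  obtain ⟨C, hC⟩ := h
  obtain ⟨C', hC'⟩ := h'.symm hu
  refine ⟨((μ V)⁻¹ * (2 * (μ W * C + μ U * C'))).toNNReal, fun i ↦ ?_⟩
  rw [ENNReal.coe_toNNReal (by finiteness)]
  calc oscillation μ (u i) U W = (μ V)⁻¹ * (μ V * oscillation μ (u i) U W) := by
        rw [← mul_assoc, ENNReal.inv_mul_cancel hV (by finiteness), one_mul]
    _ ≤ (μ V)⁻¹ * (2 * (μ W * (C * D i) + μ U * (C' * D i))) := by
        gcongr (μ V)⁻¹ * ?_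
        refine (measure_mul_oscillation_le μ (hu i) U V W).trans ?_
        gcongr
        exacts [hC i, hC' i]
    _ = _ := by ring

variable [TopologicalSpace X] [PreconnectedSpace X] [IsFiniteMeasure μ] [μ.IsOpenPosMeasure]

lemma exists_nhds_prod (hu : ∀ i, Measurable (u i))
    (hloc : ∀ x, ∃ U ∈ 𝓝 x, HasPoincareBound μ u D U U) (x y : X) :
    ∃ U ∈ 𝓝 x, ∃ V ∈ 𝓝 y, HasPoincareBound μ u D U V := by
  let Related (x y : X) : Prop := ∃ U ∈ 𝓝 x, ∃ V ∈ 𝓝 y, HasPoincareBound μ u D U V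
  have hsymm : Std.Symm Related :=
    ⟨fun x y ⟨U, hU, V, hV, h⟩ ↦ ⟨V, hV, U, hU, h.symm hu⟩⟩
  refine PreconnectedSpace.induction₂ Related (fun x ↦ ?_) ⟨?_⟩ x y
  · obtain ⟨U, hU, h⟩ := hloc x
    filter_upwards [eventually_mem_nhds_iff.2 hU] with y hy
    exact ⟨U, hU, U, hy, h⟩
  · rintro x y z ⟨U, hU, V, hV, h⟩ ⟨V', hV', W, hW, h'⟩
    exact ⟨U, hU, W, hW, (h.mono subset_rfl inter_subset_left).trans hu
      (Measure.measure_pos_of_mem_nhds μ (Filter.inter_mem hV hV')).ne'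
      (h'.mono inter_subset_right subset_rfl)⟩

theorem univ_of_local [CompactSpace X] (hu : ∀ i, Measurable (u i))
    (hloc : ∀ x, ∃ U ∈ 𝓝 x, HasPoincareBound μ u D U U) : HasPoincareBound μ u D univ univ := by
  rcases isEmpty_or_nonempty X with _ | ⟨⟨x₀⟩⟩
  · exact ⟨0, fun i ↦ by simp [oscillation]⟩
  obtain ⟨U, hU, h⟩ : ∃ U ∈ 𝓝 x₀, HasPoincareBound μ u D U univ := by
    refine isCompact_univ.induction_on (p := fun S ↦ ∃ U ∈ 𝓝 x₀, HasPoincareBound μ u D U S)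
      ⟨univ, Filter.univ_mem, 0, fun i ↦ by simp [oscillation]⟩ ?_ ?_ fun y _ ↦ ?_
    · rintro S T hST ⟨U, hU, h⟩
      exact ⟨U, hU, h.mono subset_rfl hST⟩
    · rintro S T ⟨U, hU, h⟩ ⟨U', hU', h'⟩
      exact ⟨U ∩ U', Filter.inter_mem hU hU', (h.mono inter_subset_left subset_rfl).union hu
        (h'.mono inter_subset_right subset_rfl)⟩
    · obtain ⟨U, hU, V, hV, h⟩ := exists_nhds_prod hu hloc x₀ y
      exact ⟨V, mem_nhdsWithin_of_mem_nhds hV, U, hU, h⟩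
  exact (h.symm hu).trans hu (Measure.measure_pos_of_mem_nhds μ hU).ne' h

end HasPoincareBound

end Oscillation

section Convex

lemma sq_lintegral_le_lintegral_sq {α : Type*} [MeasurableSpace α] (μ : Measure α)
    [IsProbabilityMeasure μ] {f : α → ℝ≥0∞} (hf : AEMeasurable f μ) :
    (∫⁻ x, f x ∂μ) ^ 2 ≤ ∫⁻ x, f x ^ 2 ∂μ := by
  have h := ENNReal.lintegral_mul_le_Lp_mul_Lq μ Real.HolderConjugate.two_two hf
    (aemeasurable_const (b := (1 : ℝ≥0∞)))
  simp only [Pi.mul_apply, mul_one, lintegral_const, measure_univ, ENNReal.rpow_two, one_pow,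
    ENNReal.one_rpow] at h
  calc (∫⁻ x, f x ∂μ) ^ 2 ≤ ((∫⁻ x, f x ^ 2 ∂μ) ^ (1 / 2 : ℝ)) ^ 2 := by gcongr
    _ = ∫⁻ x, f x ^ 2 ∂μ := by
      rw [← ENNReal.rpow_natCast, ← ENNReal.rpow_mul]
      norm_num

variable {E : Type*} [NormedAddCommGroup E] [NormedSpace ℝ E] {B : Set E} {v : E → ℝ}
  {v' : E → E →L[ℝ] ℝ}

lemma integral_fderiv_segment (hB : Convex ℝ B)
    (hv : ∀ y ∈ B, HasFDerivWithinAt v (v' y) B y) (hv' : ContinuousOn v' B) {y z : E}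
    (hy : y ∈ B) (hz : z ∈ B) :
    ∫ t in Icc (0 : ℝ) 1, v' (z + t • (y - z)) (y - z) = v y - v z := by
  set γ : ℝ → E := fun t ↦ z + t • (y - z)
  have hγB : MapsTo γ (Icc 0 1) B := fun t ht ↦ hB.add_smul_sub_mem hz hy ht
  have hγd (t : ℝ) : HasDerivAt γ (y - z) t := by
    simpa only [one_smul, id] using ((hasDerivAt_id t).smul_const (y - z)).const_add z
  have hd (t : ℝ) (ht : t ∈ Icc (0 : ℝ) 1) :
      HasDerivWithinAt (v ∘ γ) (v' (γ t) (y - z)) (Icc 0 1) t :=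
    (hv _ (hγB ht)).comp_hasDerivWithinAt t (hγd t).hasDerivWithinAt hγB
  have hc : ContinuousOn (fun t ↦ v' (γ t) (y - z)) (Icc 0 1) :=
    (hv'.comp (by fun_prop) hγB).clm_apply continuousOn_const
  rw [integral_Icc_eq_integral_Ioc, ← intervalIntegral.integral_of_le zero_le_one,
    intervalIntegral.integral_eq_sub_of_hasDeriv_right_of_le (f := v ∘ γ) zero_le_one
      (fun t ht ↦ (hd t ht).continuousWithinAt)
      (fun t ht ↦ ((hd t (Ioo_subset_Icc_self ht)).hasDerivAt
        (Icc_mem_nhds ht.1 ht.2)).hasDerivWithinAt)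
      (hc.intervalIntegrable_of_Icc zero_le_one)]
  simp [γ]

lemma enorm_sub_sq_le_lintegral_segment (hB : Convex ℝ B)
    (hv : ∀ y ∈ B, HasFDerivWithinAt v (v' y) B y) (hv' : ContinuousOn v' B) {y z : E}
    (hy : y ∈ B) (hz : z ∈ B) :
    ‖v y - v z‖ₑ ^ 2 ≤ ‖y - z‖ₑ ^ 2 *
      ∫⁻ t in Icc (0 : ℝ) 1, B.indicator (fun p ↦ ‖v' p‖ₑ ^ 2) (z + t • (y - z)) := by
  have hγB : MapsTo (fun t : ℝ ↦ z + t • (y - z)) (Icc 0 1) B :=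
    fun t ht ↦ hB.add_smul_sub_mem hz hy ht
  have hc : ContinuousOn (fun t : ℝ ↦ v' (z + t • (y - z)) (y - z)) (Icc 0 1) :=
    (hv'.comp (by fun_prop) hγB).clm_apply continuousOn_const
  have hP : IsProbabilityMeasure (volume.restrict (Icc (0 : ℝ) 1)) := ⟨by simp⟩
  calc ‖v y - v z‖ₑ ^ 2
      ≤ (∫⁻ t in Icc (0 : ℝ) 1, ‖v' (z + t • (y - z)) (y - z)‖ₑ) ^ 2 := by
        rw [← integral_fderiv_segment hB hv hv' hy hz]
        gcongr
        exact enorm_integral_le_lintegral_enorm _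
    _ ≤ ∫⁻ t in Icc (0 : ℝ) 1, ‖v' (z + t • (y - z)) (y - z)‖ₑ ^ 2 :=
        sq_lintegral_le_lintegral_sq _ (hc.aemeasurable measurableSet_Icc).enorm
    _ ≤ ∫⁻ t in Icc (0 : ℝ) 1,
          ‖y - z‖ₑ ^ 2 * B.indicator (fun p ↦ ‖v' p‖ₑ ^ 2) (z + t • (y - z)) := by
        refine setLIntegral_mono' measurableSet_Icc fun t ht ↦ ?_
        rw [indicator_of_mem (hγB ht), ← mul_pow, mul_comm]
        gcongr
        exact (v' _).le_opENorm _
    _ = _ := lintegral_const_mul' _ _ (by finiteness)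

variable [FiniteDimensional ℝ E] [MeasurableSpace E] [BorelSpace E] (ν : Measure E)
  [ν.IsAddHaarMeasure] {W : E → ℝ≥0∞}

lemma lintegral_comp_smul_add_le (hW : Measurable W) {t : ℝ} (ht : 1 / 2 ≤ t) (a : E) :
    ∫⁻ y, W (t • y + a) ∂ν ≤ 2 ^ Module.finrank ℝ E * ∫⁻ y, W y ∂ν := by
  have ht0 : 0 < t := by linarith
  have hmap : ∫⁻ y, W (t • y + a) ∂ν = ∫⁻ y, W (y + a) ∂(Measure.map (t • ·) ν) :=
    (lintegral_map (f := fun y ↦ W (y + a)) (by fun_prop) (measurable_const_smul t)).symm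
  rw [hmap, Measure.map_addHaar_smul ν ht0.ne', lintegral_smul_measure,
    lintegral_add_right_eq_self]
  refine mul_le_mul_left (ENNReal.ofReal_le_of_le_toReal ?_) _
  rw [ENNReal.toReal_pow, ENNReal.toReal_ofNat, abs_of_pos (by positivity),
    inv_le_comm₀ (by positivity) (by positivity), ← inv_pow]
  gcongr
  linarith

-- Substitute in the endpoint whose weight is at least `1 / 2`: its Jacobian is at most `2 ^ dim`.
lemma lintegral_lintegral_segment_le (hW : Measurable W) (B : Set E) (t : ℝ) :
    ∫⁻ z in B, ∫⁻ y in B, W (z + t • (y - z)) ∂ν ∂ν ≤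
      2 ^ Module.finrank ℝ E * (∫⁻ y, W y ∂ν) * ν B := by
  have of_half_le (t : ℝ) (ht : 1 / 2 ≤ t) :
      ∫⁻ z in B, ∫⁻ y in B, W (z + t • (y - z)) ∂ν ∂ν ≤
        2 ^ Module.finrank ℝ E * (∫⁻ y, W y ∂ν) * ν B := by
    rw [← setLIntegral_const]
    refine lintegral_mono fun z ↦ (setLIntegral_le_lintegral _ _).trans ?_
    have hsub (y : E) : z + t • (y - z) = t • y + (z - t • z) := by module
    simpa only [hsub] using lintegral_comp_smul_add_le ν hW ht (z - t • z)
  rcases le_total (1 / 2) t with ht | ht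
  · exact of_half_le t ht
  · rw [lintegral_lintegral_swap (by fun_prop)]
    have hsub (y z : E) : z + t • (y - z) = y + (1 - t) • (z - y) := by module
    simpa only [hsub] using of_half_le (1 - t) (by linarith)

theorem oscillation_le_of_convex (hB : Convex ℝ B) (hBm : MeasurableSet B) {d : ℝ≥0∞}
    (hd_top : d ≠ ⊤) (hd : ∀ y ∈ B, ∀ z ∈ B, ‖y - z‖ₑ ≤ d)
    (hv : ∀ y ∈ B, HasFDerivWithinAt v (v' y) B y) (hv' : ContinuousOn v' B) :
    oscillation ν v B B ≤
      d ^ 2 * (2 ^ Module.finrank ℝ E * ν B) * ∫⁻ y in B, ‖v' y‖ₑ ^ 2 ∂ν := by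
  set W : E → ℝ≥0∞ := B.indicator (fun p ↦ ‖v' p‖ₑ ^ 2) with hW
  have hWm : Measurable W := by
    classical
    rw [hW, ← piecewise_eq_indicator]
    exact ((ENNReal.continuous_pow 2).comp_continuousOn hv'.enorm).measurable_piecewise
      continuousOn_const hBm
  have hWB : ∫⁻ y in B, ‖v' y‖ₑ ^ 2 ∂ν = ∫⁻ y, W y ∂ν := (lintegral_indicator hBm _).symm
  rw [hWB]
  calc oscillation ν v B B
      ≤ ∫⁻ y in B, ∫⁻ z in B, d ^ 2 * (∫⁻ t in Icc (0 : ℝ) 1, W (z + t • (y - z))) ∂ν ∂ν := by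
        refine setLIntegral_mono' hBm fun y hy ↦ setLIntegral_mono' hBm fun z hz ↦ ?_
        refine (enorm_sub_sq_le_lintegral_segment hB hv hv' hy hz).trans ?_
        gcongr
        exact hd y hy z hz
    _ = d ^ 2 * ∫⁻ t in Icc (0 : ℝ) 1, ∫⁻ y in B, ∫⁻ z in B, W (z + t • (y - z)) ∂ν ∂ν := by
        simp_rw [lintegral_const_mul' (d ^ 2) _ (by finiteness)]
        congr 1
        rw [← lintegral_lintegral_swap (f := fun y t ↦ ∫⁻ z in B, W (z + t • (y - z)) ∂ν)
          (Measurable.aemeasurable (Measurable.lintegral_prod_right'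
            (f := fun p : (E × ℝ) × E ↦ W (p.2 + p.1.2 • (p.1.1 - p.2)))
            (hWm.comp (by fun_prop))))]
        exact lintegral_congr fun y ↦
          lintegral_lintegral_swap (by fun_prop)
    _ ≤ d ^ 2 * ∫⁻ t in Icc (0 : ℝ) 1, 2 ^ Module.finrank ℝ E * (∫⁻ y, W y ∂ν) * ν B := by
        gcongr with t
        rw [lintegral_lintegral_swap (by fun_prop)]
        exact lintegral_lintegral_segment_le ν hWm B t
    _ = d ^ 2 * (2 ^ Module.finrank ℝ E * ν B) * ∫⁻ y, W y ∂ν := by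
        rw [setLIntegral_const, Real.volume_Icc, sub_zero, ENNReal.ofReal_one, mul_one]
        ring

end Convex

section Charts

variable {n : ℕ} {H : Type*} [TopologicalSpace H]
  {I : ModelWithCorners ℝ (EuclideanSpace ℝ (Fin n)) H}
  {M : Type*} [TopologicalSpace M] [ChartedSpace H M] {c d : M} {y : EuclideanSpace ℝ (Fin n)}

variable [IsManifold I ∞ M]

/-- The inner product of `g` at `x`, as a bilinear form on the model space `ℝⁿ = T_x M`. -/
def innerForm (g : SmoothMetric I M) (x : M) :
    EuclideanSpace ℝ (Fin n) →L[ℝ] EuclideanSpace ℝ (Fin n) →L[ℝ] ℝ :=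
  g.inner x

/-- The derivative at `y` of the inverse of the chart at `c`. It maps the standard basis to the
coordinate frame `coordVector`. -/
def coordDeriv (I : ModelWithCorners ℝ (EuclideanSpace ℝ (Fin n)) H) (c : M)
    (y : EuclideanSpace ℝ (Fin n)) : EuclideanSpace ℝ (Fin n) →L[ℝ] EuclideanSpace ℝ (Fin n) :=
  mfderivWithin 𝓘(ℝ, EuclideanSpace ℝ (Fin n)) I (extChartAt I c).symm (range I) y

/-- The metric read in the chart at `c`: the bilinear form with matrix `metricCoeff g c y`. -/
def coordForm (g : SmoothMetric I M) (c : M) (y : EuclideanSpace ℝ (Fin n)) :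
    EuclideanSpace ℝ (Fin n) →L[ℝ] EuclideanSpace ℝ (Fin n) →L[ℝ] ℝ :=
  (innerForm g ((extChartAt I c).symm y)).bilinearComp (coordDeriv I c y) (coordDeriv I c y)

lemma coordForm_apply (g : SmoothMetric I M) (c : M) (y v w : EuclideanSpace ℝ (Fin n)) :
    coordForm g c y v w =
      innerForm g ((extChartAt I c).symm y) (coordDeriv I c y v) (coordDeriv I c y w) := rfl

lemma metricCoeff_eq_toMatrix (g : SmoothMetric I M) (c : M) (y : EuclideanSpace ℝ (Fin n)) :
    metricCoeff g c y = LinearMap.BilinForm.toMatrix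
      (EuclideanSpace.basisFun (Fin n) ℝ).toBasis (coordForm g c y).toBilinForm := by
  ext i j
  rw [LinearMap.BilinForm.toMatrix_apply]
  rfl

lemma coordDeriv_extChartAt {x : M} (hx : x ∈ (extChartAt I c).source) :
    coordDeriv I c (extChartAt I c x) = tangentCoordChange I c x x := by
  rw [extChartAt_source] at hx
  exact (TangentBundle.symmL_trivializationAt hx).symm.trans
    (TangentBundle.symmL_trivializationAt_eq_core hx)

lemma symm_trivializationAt_apply {x : M} (hx : x ∈ (extChartAt I c).source)
    (v : EuclideanSpace ℝ (Fin n)) :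
    (trivializationAt (EuclideanSpace ℝ (Fin n)) (TangentSpace I) c).symm x v =
      coordDeriv I c (extChartAt I c x) v := by
  rw [extChartAt_source] at hx
  exact (Bundle.Trivialization.symmL_apply (R := ℝ) _ hx v).symm.trans
    (congrArg (fun T ↦ T v) (TangentBundle.symmL_trivializationAt (I := I) hx))

lemma coordDeriv_injective (hy : y ∈ (extChartAt I c).target) :
    Function.Injective (coordDeriv I c y) :=
  (isInvertible_mfderivWithin_extChartAt_symm hy).injective

lemma coordDeriv_tangentCoordChange {x : M} (hc : x ∈ (extChartAt I c).source)
    (hd : x ∈ (extChartAt I d).source) (v : EuclideanSpace ℝ (Fin n)) :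
    coordDeriv I d (extChartAt I d x) (tangentCoordChange I c d x v) =
      coordDeriv I c (extChartAt I c x) v := by
  rw [coordDeriv_extChartAt hc, coordDeriv_extChartAt hd]
  exact tangentCoordChange_comp ⟨⟨hc, hd⟩, mem_extChartAt_source x⟩

lemma coordForm_tangentCoordChange (g : SmoothMetric I M) {x : M}
    (hc : x ∈ (extChartAt I c).source) (hd : x ∈ (extChartAt I d).source)
    (v w : EuclideanSpace ℝ (Fin n)) :
    coordForm g d (extChartAt I d x) (tangentCoordChange I c d x v) (tangentCoordChange I c d x w) =
      coordForm g c (extChartAt I c x) v w := by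
  rw [coordForm_apply, coordForm_apply, coordDeriv_tangentCoordChange hc hd,
    coordDeriv_tangentCoordChange hc hd, (extChartAt I c).left_inv hc, (extChartAt I d).left_inv hd]

lemma det_metricCoeff_extChartAt (g : SmoothMetric I M) {x : M}
    (hc : x ∈ (extChartAt I c).source) (hd : x ∈ (extChartAt I d).source) :
    (metricCoeff g c (extChartAt I c x)).det =
      (tangentCoordChange I c d x).det ^ 2 * (metricCoeff g d (extChartAt I d x)).det := by
  set A := tangentCoordChange I c d x
  have hcomp : (coordForm g c (extChartAt I c x)).toBilinForm =
      (coordForm g d (extChartAt I d x)).toBilinForm.comp A.toLinearMap A.toLinearMap := by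
    ext v w
    exact (coordForm_tangentCoordChange g hc hd v w).symm
  rw [metricCoeff_eq_toMatrix, hcomp, LinearMap.BilinForm.toMatrix_comp
    (EuclideanSpace.basisFun (Fin n) ℝ).toBasis, ← metricCoeff_eq_toMatrix, Matrix.det_mul,
    Matrix.det_mul, Matrix.det_transpose, LinearMap.det_toMatrix, ContinuousLinearMap.det]
  ring

lemma linearIndependent_coordVector (hy : y ∈ (extChartAt I c).target) :
    LinearIndependent ℝ (coordVector I c y) :=
  (EuclideanSpace.basisFun (Fin n) ℝ).toBasis.linearIndependent.map' (coordDeriv I c y).toLinearMap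
    (LinearMap.ker_eq_bot.2 (coordDeriv_injective hy))

lemma posDef_metricCoeff (g : SmoothMetric I M) (hy : y ∈ (extChartAt I c).target) :
    (metricCoeff g c y).PosDef := by
  refine Matrix.PosDef.of_dotProduct_mulVec_pos ?_ fun {a} ha ↦ ?_
  · ext i j
    exact g.symm _ _ _
  · have hform : star a ⬝ᵥ (metricCoeff g c y).mulVec a =
        coordForm g c y (WithLp.toLp 2 a) (WithLp.toLp 2 a) := by
      rw [metricCoeff_eq_toMatrix]
      exact (LinearMap.BilinForm.apply_eq_dotProduct_toMatrix_mulVec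
        (EuclideanSpace.basisFun (Fin n) ℝ).toBasis (coordForm g c y).toBilinForm
        (WithLp.toLp 2 a) (WithLp.toLp 2 a)).symm
    rw [hform]
    refine g.pos _ _ fun hzero ↦ ha ?_
    simpa using coordDeriv_injective hy (hzero.trans (map_zero (coordDeriv I c y)).symm)

lemma continuousOn_coordForm (g : SmoothMetric I M) (c : M) :
    ContinuousOn (coordForm g c) (extChartAt I c).target := by
  have hsource : ContinuousOn (fun x ↦ coordForm g c (extChartAt I c x)) (chartAt H c).source := by
    intro x hx
    have (x : M) : ContinuousAdd (TangentSpace I x →L[ℝ] ℝ) := inferInstance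
    have hsection := ((trivializationAt
      (EuclideanSpace ℝ (Fin n) →L[ℝ] EuclideanSpace ℝ (Fin n) →L[ℝ] ℝ)
      (fun x : M ↦ TangentSpace I x →L[ℝ] TangentSpace I x →L[ℝ] ℝ) c).contMDiffAt_section_iff
      (by exact ⟨hx, hx, trivial⟩)).1 (g.contMDiff x)
    refine (hsection.continuousAt.congr ?_).continuousWithinAt
    filter_upwards [(chartAt H c).open_source.mem_nhds hx] with z hz
    have hz' : z ∈ (extChartAt I c).source := by simpa using hz
    rw [hom_trivializationAt_apply]
    ext v w
    refine (inCoordinates_apply_eq₂ (E₁ := fun p : M ↦ TangentSpace I p)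
      (E₂ := fun p : M ↦ TangentSpace I p) (E₃ := Bundle.Trivial M ℝ) hz hz (mem_univ _)).trans ?_
    rw [coordForm_apply, (extChartAt I c).left_inv hz', ← symm_trivializationAt_apply hz',
      ← symm_trivializationAt_apply hz']
    exact congrArg (fun T : ℝ →ₗ[ℝ] ℝ ↦ T _)
      (Bundle.Trivial.linearMapAt_trivialization ℝ M ℝ z)
  refine (hsource.comp (continuousOn_extChartAt_symm c) fun y hy ↦ ?_).congr fun y hy ↦ ?_
  · simpa using (extChartAt I c).map_target hy
  · exact (congrArg (coordForm g c) ((extChartAt I c).right_inv hy)).symm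

lemma continuousOn_metricCoeff (g : SmoothMetric I M) (c : M) :
    ContinuousOn (metricCoeff g c) (extChartAt I c).target := by
  refine continuousOn_pi.2 fun i ↦ continuousOn_pi.2 fun j ↦ ?_
  exact ((continuousOn_coordForm g c).clm_apply continuousOn_const).clm_apply continuousOn_const

end Charts

section Gradient

variable {n : ℕ} {H : Type*} [TopologicalSpace H]
  {I : ModelWithCorners ℝ (EuclideanSpace ℝ (Fin n)) H}
  {M : Type*} [TopologicalSpace M] [ChartedSpace H M] {c : M} {y : EuclideanSpace ℝ (Fin n)}

lemma mdifferentiableAt_smooth (u : C^∞⟮I, M; 𝓘(ℝ, ℝ), ℝ⟯) (x : M) :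
    MDifferentiableAt I 𝓘(ℝ, ℝ) u x :=
  (u.contMDiff x).mdifferentiableAt (by simp)

variable [IsManifold I ∞ M]

/-- The pointwise inner product `⟨∇u, ∇φ⟩` of two gradients. -/
def gradInner (g : SmoothMetric I M) (u φ : M → ℝ) (x : M) : ℝ :=
  g.inner x (grad g u x) (grad g φ x)

lemma gradInner_eq_differential (g : SmoothMetric I M) (u φ : M → ℝ) (x : M) :
    gradInner g u φ x = differential I u x (grad g φ x) :=
  inner_grad g u x _

lemma gradInner_comm (g : SmoothMetric I M) (u φ : M → ℝ) (x : M) :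
    gradInner g u φ x = gradInner g φ u x :=
  g.symm x _ _

lemma inner_self_nonneg (g : SmoothMetric I M) (x : M) (v : TangentSpace I x) :
    0 ≤ g.inner x v v := by
  by_cases hv : v = 0
  · simp [hv]
  · exact (g.pos x v hv).le

lemma inner_sq_le (g : SmoothMetric I M) (x : M) (v w : TangentSpace I x) :
    g.inner x v w ^ 2 ≤ g.inner x v v * g.inner x w w :=
  LinearMap.BilinForm.apply_sq_le_of_symm (innerForm g x).toBilinForm
    (fun v ↦ inner_self_nonneg g x v) ⟨fun v w ↦ g.symm x v w⟩ v w

lemma gradInner_self_nonneg (g : SmoothMetric I M) (u : M → ℝ) (x : M) :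
    0 ≤ gradInner g u u x :=
  inner_self_nonneg g x _

/-- The derivative of `u`, read in the chart at `c`. -/
def chartFDeriv (I : ModelWithCorners ℝ (EuclideanSpace ℝ (Fin n)) H) (u : M → ℝ) (c : M)
    (y : EuclideanSpace ℝ (Fin n)) : EuclideanSpace ℝ (Fin n) →L[ℝ] ℝ :=
  fderivWithin ℝ (u ∘ (extChartAt I c).symm) (range I) y

lemma differential_coordDeriv (u : C^∞⟮I, M; 𝓘(ℝ, ℝ), ℝ⟯) (hy : y ∈ (extChartAt I c).target)
    (v : EuclideanSpace ℝ (Fin n)) :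
    differential I u ((extChartAt I c).symm y) (coordDeriv I c y v) = chartFDeriv I u c y v := by
  have hcomp := mfderiv_comp_mfderivWithin (I := 𝓘(ℝ, EuclideanSpace ℝ (Fin n))) (I' := I)
    (I'' := 𝓘(ℝ, ℝ)) (x := y) (s := range I) (mdifferentiableAt_smooth u _)
    (mdifferentiableWithinAt_extChartAt_symm hy)
    (I.uniqueMDiffOn y (extChartAt_target_subset_range _ hy))
  rw [chartFDeriv, ← mfderivWithin_eq_fderivWithin, hcomp]
  rfl

lemma contDiffWithinAt_comp_symm (u : C^∞⟮I, M; 𝓘(ℝ, ℝ), ℝ⟯) (hy : y ∈ (extChartAt I c).target) :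
    ContDiffWithinAt ℝ ∞ (u ∘ (extChartAt I c).symm) (range I) y :=
  ((u.contMDiff _).comp_contMDiffWithinAt y
    (contMDiffWithinAt_extChartAt_symm_range c hy)).contDiffWithinAt

lemma continuousOn_chartFDeriv (u : C^∞⟮I, M; 𝓘(ℝ, ℝ), ℝ⟯) (c : M) :
    ContinuousOn (chartFDeriv I u c) (extChartAt I c).target := fun _ hy ↦
  (((contDiffWithinAt_comp_symm u hy).fderivWithin_right (m := 0) I.uniqueDiffOn (by simp)
    (extChartAt_target_subset_range _ hy)).continuousWithinAt).mono
      (extChartAt_target_subset_range c)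

lemma chartFDeriv_sq_le (g : SmoothMetric I M) (u : C^∞⟮I, M; 𝓘(ℝ, ℝ), ℝ⟯)
    (hy : y ∈ (extChartAt I c).target) :
    ‖chartFDeriv I u c y‖ ^ 2 ≤
      ‖coordForm g c y‖ * gradInner g u u ((extChartAt I c).symm y) := by
  have hgrad := gradInner_self_nonneg g u ((extChartAt I c).symm y)
  rw [← Real.le_sqrt (norm_nonneg _) (by positivity)]
  refine ContinuousLinearMap.opNorm_le_bound _ (Real.sqrt_nonneg _) fun v ↦ ?_
  rw [Real.norm_eq_abs]
  refine abs_le_of_sq_le_sq ?_ (by positivity)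
  rw [mul_pow, Real.sq_sqrt (by positivity)]
  calc chartFDeriv I u c y v ^ 2
      = g.inner _ (grad g u ((extChartAt I c).symm y)) (coordDeriv I c y v) ^ 2 := by
        rw [← differential_coordDeriv u hy]
        exact congrArg (· ^ 2) (inner_grad g u _ _).symm
    _ ≤ gradInner g u u ((extChartAt I c).symm y) * coordForm g c y v v := inner_sq_le g _ _ _
    _ ≤ gradInner g u u ((extChartAt I c).symm y) * (‖coordForm g c y‖ * ‖v‖ * ‖v‖) := by
        gcongr
        exact (le_abs_self _).trans ((coordForm g c y).le_opNorm₂ v v)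
    _ = ‖coordForm g c y‖ * gradInner g u u ((extChartAt I c).symm y) * ‖v‖ ^ 2 := by ring

/-- The derivative of `u` in the direction `∂ᵢ` of the chart at `c`. -/
def partialDeriv (I : ModelWithCorners ℝ (EuclideanSpace ℝ (Fin n)) H) (u : M → ℝ) (c : M)
    (y : EuclideanSpace ℝ (Fin n)) (i : Fin n) : ℝ :=
  chartFDeriv I u c y (EuclideanSpace.basisFun (Fin n) ℝ i)

lemma differential_coordVector (u : C^∞⟮I, M; 𝓘(ℝ, ℝ), ℝ⟯) (hy : y ∈ (extChartAt I c).target)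
    (i : Fin n) :
    differential I u ((extChartAt I c).symm y) (coordVector I c y i) = partialDeriv I u c y i := by
  rw [partialDeriv, ← differential_coordDeriv u hy]
  simp only [coordVector, frame]
  rfl

lemma gradInner_symm_eq (g : SmoothMetric I M) (u φ : C^∞⟮I, M; 𝓘(ℝ, ℝ), ℝ⟯)
    (hy : y ∈ (extChartAt I c).target) :
    gradInner g u φ ((extChartAt I c).symm y) =
      Matrix.vecMul (partialDeriv I u c y) (metricCoeff g c y)⁻¹ ⬝ᵥ partialDeriv I φ c y := by
  have hfinite : FiniteDimensional ℝ (TangentSpace I ((extChartAt I c).symm y)) :=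
    inferInstanceAs (FiniteDimensional ℝ (EuclideanSpace ℝ (Fin n)))
  have hspan : Submodule.span ℝ (range (coordVector I c y)) = ⊤ :=
    (linearIndependent_coordVector hy).span_eq_top_of_card_eq_finrank'
      ((Fintype.card_fin n).trans (finrank_euclideanSpace_fin (𝕜 := ℝ) (n := n)).symm)
  obtain ⟨a, ha⟩ : ∃ a : Fin n → ℝ, ∑ i, a i • coordVector I c y i = grad g u _ :=
    (Submodule.mem_span_range_iff_exists_fun ℝ).1 (hspan ▸ Submodule.mem_top)
  have hu : partialDeriv I u c y = Matrix.vecMul a (metricCoeff g c y) := by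
    ext j
    rw [← differential_coordVector u hy, ← inner_grad g, ← ha]
    simp only [map_sum, map_smul, sum_apply, smul_apply, smul_eq_mul]
    rfl
  have hφ : gradInner g u φ ((extChartAt I c).symm y) = a ⬝ᵥ partialDeriv I φ c y := by
    rw [gradInner_comm, gradInner_eq_differential, ← ha]
    simp only [map_sum, map_smul, smul_eq_mul, differential_coordVector φ hy, dotProduct]
  rw [hφ, hu, Matrix.vecMul_vecMul,
    Matrix.mul_nonsing_inv _ (posDef_metricCoeff g hy).det_pos.ne'.isUnit, Matrix.vecMul_one]

lemma continuousOn_inv_metricCoeff (g : SmoothMetric I M) (c : M) :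
    ContinuousOn (fun y ↦ (metricCoeff g c y)⁻¹) (extChartAt I c).target := by
  have hG := continuousOn_metricCoeff g c
  simp only [Matrix.inv_def, Ring.inverse_eq_inv']
  exact ((continuous_id.matrix_det.comp_continuousOn hG).inv₀
    fun y hy ↦ (posDef_metricCoeff g hy).det_pos.ne').smul
      (continuous_id.matrix_adjugate.comp_continuousOn hG)

lemma continuousOn_partialDeriv (u : C^∞⟮I, M; 𝓘(ℝ, ℝ), ℝ⟯) (c : M) :
    ContinuousOn (partialDeriv I u c) (extChartAt I c).target :=
  continuousOn_pi.2 fun _ ↦ (continuousOn_chartFDeriv u c).clm_apply continuousOn_const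

lemma continuous_gradInner (g : SmoothMetric I M) (u φ : C^∞⟮I, M; 𝓘(ℝ, ℝ), ℝ⟯) :
    Continuous (gradInner g u φ) := by
  refine continuous_iff_continuousAt.2 fun c ↦ ?_
  have hchart : ContinuousOn (fun y ↦ gradInner g u φ ((extChartAt I c).symm y))
      (extChartAt I c).target := by
    have hpairing : Continuous fun p : ((Fin n → ℝ) × Matrix (Fin n) (Fin n) ℝ) × (Fin n → ℝ) ↦
        Matrix.vecMul p.1.1 p.1.2 ⬝ᵥ p.2 := by fun_prop
    exact (hpairing.comp_continuousOn (((continuousOn_partialDeriv u c).prodMk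
      (continuousOn_inv_metricCoeff g c)).prodMk (continuousOn_partialDeriv φ c))).congr
      fun y hy ↦ gradInner_symm_eq g u φ hy
  refine ((hchart.comp (continuousOn_extChartAt c) (extChartAt I c).mapsTo).continuousAt
    (extChartAt_source_mem_nhds c)).congr ?_
  filter_upwards [extChartAt_source_mem_nhds (I := I) c] with x hx
  simp only [Function.comp, (extChartAt I c).left_inv hx]

end Gradient

section Volume

variable {n : ℕ} {H : Type*} [TopologicalSpace H]
  {I : ModelWithCorners ℝ (EuclideanSpace ℝ (Fin n)) H}
  {M : Type*} [TopologicalSpace M] [ChartedSpace H M] {A U : Set M}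

/-- The part of `U` in the domain of the chart at `c`, read in that chart. -/
def coordImage (I : ModelWithCorners ℝ (EuclideanSpace ℝ (Fin n)) H) (c : M) (U : Set M) :
    Set (EuclideanSpace ℝ (Fin n)) :=
  (extChartAt I c).target ∩ (extChartAt I c).symm ⁻¹' U

lemma measurableSet_target (c : M) : MeasurableSet (extChartAt I c).target := by
  rw [extChartAt_target]
  exact ((chartAt H c).open_target.preimage I.continuous_symm).measurableSet.inter
    I.isClosed_range.measurableSet

lemma measurableSet_coordImage (c : M) (hU : MeasurableSet[borel M] U) :
    MeasurableSet (coordImage I c U) := by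
  borelize M
  have hpre := (continuousOn_iff_continuous_domRestrict.1
    (continuousOn_extChartAt_symm (I := I) c)).measurable hU
  have himage := (measurableSet_target (I := I) c).subtype_image hpre
  rwa [domRestrict_eq, preimage_comp, Subtype.image_preimage_coe] at himage

lemma aemeasurable_symm (c : M) :
    @AEMeasurable _ M (borel M) _ (extChartAt I c).symm
      (volume.restrict (extChartAt I c).target) := by
  borelize M
  exact (continuousOn_extChartAt_symm c).aemeasurable (measurableSet_target c)

variable [IsManifold I ∞ M]

/-- The density `√(det gᵢⱼ)` of the Riemannian volume in the chart at `c`. -/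
def density (g : SmoothMetric I M) (c : M) (y : EuclideanSpace ℝ (Fin n)) : ℝ≥0∞ :=
  ENNReal.ofReal (Real.sqrt (metricCoeff g c y).det)

lemma continuousOn_density (g : SmoothMetric I M) (c : M) :
    ContinuousOn (density g c) (extChartAt I c).target :=
  (ENNReal.continuous_ofReal.comp
    (Real.continuous_sqrt.comp continuous_id.matrix_det)).comp_continuousOn
    (continuousOn_metricCoeff g c)

lemma density_pos (g : SmoothMetric I M) {c : M} {y : EuclideanSpace ℝ (Fin n)}
    (hy : y ∈ (extChartAt I c).target) : 0 < density g c y :=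
  ENNReal.ofReal_pos.2 (Real.sqrt_pos.2 (posDef_metricCoeff g hy).det_pos)

lemma density_extChartAt (g : SmoothMetric I M) {c d x : M} (hc : x ∈ (extChartAt I c).source)
    (hd : x ∈ (extChartAt I d).source) :
    density g c (extChartAt I c x) =
      ENNReal.ofReal |(tangentCoordChange I c d x).det| * density g d (extChartAt I d x) := by
  rw [density, density, det_metricCoeff_extChartAt g hc hd, Real.sqrt_mul (sq_nonneg _),
    Real.sqrt_sq_eq_abs, ENNReal.ofReal_mul (abs_nonneg _)]

lemma chartVolume_apply (g : SmoothMetric I M) (c : M) (hA : MeasurableSet[borel M] A) :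
    chartVolume g c A = ∫⁻ y in coordImage I c A, density g c y := by
  borelize M
  rw [chartVolume, Measure.map_apply_of_aemeasurable
    ((aemeasurable_symm c).mono_ac (withDensity_absolutelyContinuous _ _)) hA,
    withDensity_apply', Measure.restrict_restrict' (measurableSet_target c), inter_comm]
  rfl

lemma lintegral_chartVolume (g : SmoothMetric I M) (c : M) {F : M → ℝ≥0∞}
    (hF : Measurable[borel M] F) :
    ∫⁻ x, F x ∂(chartVolume g c) =
      ∫⁻ y in (extChartAt I c).target, density g c y * F ((extChartAt I c).symm y) := by
  borelize M
  rw [chartVolume, lintegral_map' hF.aemeasurable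
    ((aemeasurable_symm c).mono_ac (withDensity_absolutelyContinuous _ _))]
  exact lintegral_withDensity_eq_lintegral_mul₀
    ((continuousOn_density g c).aemeasurable (measurableSet_target c))
    (hF.comp_aemeasurable (aemeasurable_symm c))

lemma chartVolume_le (g : SmoothMetric I M) (c d : M) (hA : MeasurableSet[borel M] A)
    (hAd : A ⊆ (extChartAt I d).source) : chartVolume g c A ≤ chartVolume g d A := by
  set φ := extChartAt I d ∘ (extChartAt I c).symm
  have hsub : φ '' coordImage I c A ⊆ coordImage I d A := by
    rintro _ ⟨y, hy, rfl⟩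
    refine ⟨(extChartAt I d).map_source (hAd hy.2), ?_⟩
    rw [mem_preimage]
    exact ((extChartAt I d).left_inv (hAd hy.2)).symm ▸ hy.2
  have hinj : InjOn φ (coordImage I c A) := fun y hy z hz h ↦
    (extChartAt I c).symm.injOn hy.1 hz.1 ((extChartAt I d).injOn (hAd hy.2) (hAd hz.2) h)
  have hderiv (y) (hy : y ∈ coordImage I c A) : HasFDerivWithinAt φ
      (tangentCoordChange I c d ((extChartAt I c).symm y)) (coordImage I c A) y := by
    have h := hasFDerivWithinAt_tangentCoordChange (I := I)
      ⟨(extChartAt I c).map_target hy.1, hAd hy.2⟩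
    rw [(extChartAt I c).right_inv hy.1] at h
    exact h.mono fun z hz ↦ extChartAt_target_subset_range _ hz.1
  rw [chartVolume_apply g c hA, chartVolume_apply g d hA]
  calc ∫⁻ y in coordImage I c A, density g c y
      = ∫⁻ y in coordImage I c A,
          ENNReal.ofReal |(tangentCoordChange I c d ((extChartAt I c).symm y)).det| *
            density g d (φ y) := by
        refine setLIntegral_congr_fun (measurableSet_coordImage c hA) fun y hy ↦ ?_
        have h := density_extChartAt g ((extChartAt I c).map_target hy.1) (hAd hy.2)
        rwa [(extChartAt I c).right_inv hy.1] at h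
    _ = ∫⁻ z in φ '' coordImage I c A, density g d z :=
        (lintegral_image_eq_lintegral_abs_det_fderiv_mul volume (measurableSet_coordImage c hA)
          hderiv hinj _).symm
    _ ≤ ∫⁻ z in coordImage I d A, density g d z := lintegral_mono_set hsub

lemma chartVolume_compl_source (g : SmoothMetric I M) (c : M) :
    chartVolume g c (extChartAt I c).sourceᶜ = 0 := by
  borelize M
  rw [chartVolume_apply g c (isOpen_extChartAt_source c).measurableSet.compl]
  convert setLIntegral_empty _
  exact eq_empty_of_forall_notMem fun y hy ↦ hy.2 ((extChartAt I c).map_target hy.1)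

lemma volumeMeasure_restrict_source (g : SmoothMetric I M) (c : M) :
    (volumeMeasure g).restrict (extChartAt I c).source = chartVolume g c := by
  borelize M
  have hS : MeasurableSet (extChartAt I c).source := (isOpen_extChartAt_source c).measurableSet
  have hle : volumeMeasure g ≤
      chartVolume g c + (⊤ : Measure M).restrict (extChartAt I c).sourceᶜ := by
    refine iSup_le fun d ↦ Measure.le_iff.2 fun A hA ↦ ?_
    rw [← measure_inter_add_sdiff A hS, Measure.add_apply, Measure.restrict_apply hA, ← sdiff_eq]
    exact add_le_add ((chartVolume_le g d c (hA.inter hS) inter_subset_right).trans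
      (measure_mono inter_subset_left)) (Measure.le_iff'.1 le_top _)
  refine le_antisymm ((Measure.restrict_mono_measure hle _).trans_eq ?_) ?_
  · rw [Measure.restrict_add, Measure.restrict_restrict hS, inter_compl_self,
      Measure.restrict_empty, add_zero, Measure.restrict_eq_self_of_ae_mem]
    exact chartVolume_compl_source g c
  · rw [← Measure.restrict_eq_self_of_ae_mem (chartVolume_compl_source g c)]
    exact Measure.restrict_mono_measure (le_iSup (chartVolume g) c) _

lemma setLIntegral_volumeMeasure (g : SmoothMetric I M) (c : M) (hU : MeasurableSet[borel M] U)
    (hUc : U ⊆ (extChartAt I c).source) {F : M → ℝ≥0∞} (hF : Measurable[borel M] F) :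
    ∫⁻ x in U, F x ∂(volumeMeasure g) =
      ∫⁻ y in coordImage I c U, density g c y * F ((extChartAt I c).symm y) := by
  borelize M
  rw [← inter_eq_self_of_subset_left hUc, ← Measure.restrict_restrict hU,
    volumeMeasure_restrict_source, inter_eq_self_of_subset_left hUc, ← lintegral_indicator hU,
    lintegral_chartVolume g c (hF.indicator hU), ← lintegral_indicator (measurableSet_target c),
    ← lintegral_indicator (measurableSet_coordImage c hU), coordImage, ← indicator_indicator]
  refine lintegral_congr fun y ↦ ?_
  congr 1
  ext z
  by_cases hz : (extChartAt I c).symm z ∈ U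
  · rw [indicator_of_mem hz, indicator_of_mem (mem_preimage.2 hz)]
  · rw [indicator_of_notMem hz, indicator_of_notMem (mt mem_preimage.1 hz), mul_zero]

lemma setLIntegral_volumeMeasure_le (g : SmoothMetric I M) {c : M} (hU : MeasurableSet[borel M] U)
    (hUc : U ⊆ (extChartAt I c).source) {K : ℝ≥0∞} (hK : K ≠ ⊤)
    (hdensity : ∀ y ∈ coordImage I c U, density g c y ≤ K) {F : M → ℝ≥0∞}
    (hF : Measurable[borel M] F) :
    ∫⁻ x in U, F x ∂(volumeMeasure g) ≤
      K * ∫⁻ y in coordImage I c U, F ((extChartAt I c).symm y) := by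
  rw [setLIntegral_volumeMeasure g c hU hUc hF, ← lintegral_const_mul' _ _ hK]
  refine setLIntegral_mono' (measurableSet_coordImage c hU) fun y hy ↦ ?_
  gcongr
  exact hdensity y hy

lemma le_setLIntegral_volumeMeasure (g : SmoothMetric I M) {c : M} (hU : MeasurableSet[borel M] U)
    (hUc : U ⊆ (extChartAt I c).source) {m : ℝ≥0∞}
    (hdensity : ∀ y ∈ coordImage I c U, m ≤ density g c y) {F : M → ℝ≥0∞}
    (hF : Measurable[borel M] F) :
    m * ∫⁻ y in coordImage I c U, F ((extChartAt I c).symm y) ≤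
      ∫⁻ x in U, F x ∂(volumeMeasure g) := by
  rw [setLIntegral_volumeMeasure g c hU hUc hF]
  refine (lintegral_const_mul_le _ _).trans ?_
  refine setLIntegral_mono' (measurableSet_coordImage c hU) fun y hy ↦ ?_
  gcongr
  exact hdensity y hy

end Volume

section ChartBall

variable {n : ℕ} {H : Type*} [TopologicalSpace H]
  {I : ModelWithCorners ℝ (EuclideanSpace ℝ (Fin n)) H}
  {M : Type*} [TopologicalSpace M] [ChartedSpace H M]

/-- The part of `M` that the chart at `c` maps into the ball of radius `r` about the image of `c`.
If `c` is a boundary point, this is a half ball in the chart. -/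
def chartBall (I : ModelWithCorners ℝ (EuclideanSpace ℝ (Fin n)) H) (c : M) (r : ℝ) : Set M :=
  (extChartAt I c).source ∩ extChartAt I c ⁻¹' Metric.ball (extChartAt I c c) r

lemma isOpen_chartBall (c : M) (r : ℝ) : IsOpen (chartBall I c r) :=
  (continuousOn_extChartAt c).isOpen_inter_preimage (isOpen_extChartAt_source c) Metric.isOpen_ball

lemma chartBall_mem_nhds (c : M) {r : ℝ} (hr : 0 < r) : chartBall I c r ∈ 𝓝 c :=
  (isOpen_chartBall c r).mem_nhds ⟨mem_extChartAt_source c, Metric.mem_ball_self hr⟩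

lemma coordImage_chartBall (c : M) {r : ℝ}
    (h : Metric.ball (extChartAt I c c) r ∩ range I ⊆ (extChartAt I c).target) :
    coordImage I c (chartBall I c r) = Metric.ball (extChartAt I c c) r ∩ range I := by
  ext y
  constructor
  · rintro ⟨hy, -, hball⟩
    rw [mem_preimage, (extChartAt I c).right_inv hy] at hball
    exact ⟨hball, extChartAt_target_subset_range _ hy⟩
  · intro hy
    refine ⟨h hy, (extChartAt I c).map_target (h hy), ?_⟩
    rw [mem_preimage, (extChartAt I c).right_inv (h hy)]
    exact hy.1

lemma coordImage_mem_nhdsWithin (c : M) {U : Set M} (hU : U ∈ 𝓝 c) :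
    coordImage I c U ∈ 𝓝[range I] extChartAt I c c := by
  refine Filter.inter_mem (extChartAt_target_mem_nhdsWithin c) ?_
  refine (continuousAt_extChartAt_symm (I := I) c).continuousWithinAt.preimage_mem_nhdsWithin ?_
  rwa [extChartAt_to_inv]

lemma volume_pos_of_mem_nhdsWithin_range {y : EuclideanSpace ℝ (Fin n)} (hy : y ∈ range I)
    {s : Set (EuclideanSpace ℝ (Fin n))} (hs : s ∈ 𝓝[range I] y) : 0 < volume s := by
  obtain ⟨t, ht, hyt, hts⟩ := mem_nhdsWithin.1 hs
  have hne : (t ∩ interior (range I)).Nonempty :=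
    mem_closure_iff.1 (I.range_subset_closure_interior hy) t ht hyt
  exact ((ht.inter isOpen_interior).measure_pos volume hne).trans_le
    (measure_mono ((inter_subset_inter_right _ interior_subset).trans hts))

variable [IsManifold I ∞ M]

lemma exists_chartBall_bounds (g : SmoothMetric I M) (c : M) :
    ∃ r > 0, coordImage I c (chartBall I c r) = Metric.ball (extChartAt I c c) r ∩ range I ∧
      ∃ m K : ℝ≥0∞, m ≠ 0 ∧ K ≠ ⊤ ∧ ∀ y ∈ coordImage I c (chartBall I c r),
        m ≤ density g c y ∧ density g c y ≤ K ∧ ‖coordForm g c y‖ₑ ≤ K := by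
  have hc := mem_extChartAt_target (I := I) c
  have hdensity := continuousOn_density g c _ hc
  have hform := ((ENNReal.continuous_coe.comp (continuous_nnnorm
    (E := EuclideanSpace ℝ (Fin n) →L[ℝ] EuclideanSpace ℝ (Fin n) →L[ℝ] ℝ))).comp_continuousOn
      (continuousOn_coordForm g c)) _ hc
  rw [ContinuousWithinAt, nhdsWithin_extChartAt_target_eq] at hdensity hform
  obtain ⟨m, hm, hmlt⟩ := exists_between (density_pos g hc)
  obtain ⟨K, hKlt, hK⟩ := exists_between
    (max_lt ENNReal.ofReal_lt_top ENNReal.coe_lt_top :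
      max (density g c (extChartAt I c c)) ‖coordForm g c (extChartAt I c c)‖ₑ < ⊤)
  obtain ⟨r, hr, h⟩ := Metric.mem_nhdsWithin_iff.1 (Filter.inter_mem
    (extChartAt_target_mem_nhdsWithin (I := I) c) (Filter.inter_mem
      (hdensity.eventually_const_lt hmlt) (Filter.inter_mem
        (hdensity.eventually_lt_const (max_lt_iff.1 hKlt).1)
        (hform.eventually_lt_const (max_lt_iff.1 hKlt).2))))
  have hball := coordImage_chartBall c fun y hy ↦ (h hy).1
  refine ⟨r, hr, hball, m, K, hm.ne', hK.ne, fun y hy ↦ ?_⟩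
  obtain ⟨-, h₁, h₂, h₃⟩ := h (hball ▸ hy)
  exact ⟨le_of_lt h₁, le_of_lt h₂, le_of_lt h₃⟩

instance isLocallyFiniteMeasure_volumeMeasure (g : SmoothMetric I M) :
    IsLocallyFiniteMeasure (volumeMeasure g) := by
  borelize M
  refine ⟨fun c ↦ ?_⟩
  obtain ⟨r, hr, hball, _, K, -, hK, h⟩ := exists_chartBall_bounds g c
  refine ⟨chartBall I c r, chartBall_mem_nhds c hr, ?_⟩
  have hle := setLIntegral_volumeMeasure_le g (isOpen_chartBall c r).measurableSet
    inter_subset_left hK (fun y hy ↦ (h y hy).2.1) (measurable_const (a := 1))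
  rw [setLIntegral_one, setLIntegral_one, hball] at hle
  exact hle.trans_lt (ENNReal.mul_lt_top hK.lt_top
    ((measure_mono inter_subset_left).trans_lt measure_ball_lt_top))

instance isOpenPosMeasure_volumeMeasure (g : SmoothMetric I M) :
    (volumeMeasure g).IsOpenPosMeasure := by
  borelize M
  refine ⟨fun U hU ⟨c, hc⟩ ↦ ?_⟩
  obtain ⟨r, hr, -, m, _, hm, -, h⟩ := exists_chartBall_bounds g c
  set V := U ∩ chartBall I c r
  have hV : IsOpen V := hU.inter (isOpen_chartBall c r)
  have hle := le_setLIntegral_volumeMeasure g hV.measurableSet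
    (inter_subset_right.trans inter_subset_left) (fun y hy ↦ (h y ⟨hy.1, hy.2.2⟩).1)
    (measurable_const (a := 1))
  rw [setLIntegral_one, setLIntegral_one] at hle
  have hpos : 0 < volume (coordImage I c V) :=
    volume_pos_of_mem_nhdsWithin_range (extChartAt_target_subset_range _ (mem_extChartAt_target c))
      (coordImage_mem_nhdsWithin c (Filter.inter_mem (hU.mem_nhds hc) (chartBall_mem_nhds c hr)))
  exact ((ENNReal.mul_pos hm hpos.ne').trans_le
    (hle.trans (measure_mono inter_subset_left))).ne'

end ChartBall

section Poincare

variable {n : ℕ} {H : Type*} [TopologicalSpace H]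
  {I : ModelWithCorners ℝ (EuclideanSpace ℝ (Fin n)) H}
  {M : Type*} [TopologicalSpace M] [ChartedSpace H M]

lemma measurable_contMDiffMap (u : C^∞⟮I, M; 𝓘(ℝ, ℝ), ℝ⟯) : Measurable[borel M] u := by
  borelize M
  exact u.contMDiff.continuous.measurable

variable [IsManifold I ∞ M]

/-- The Dirichlet energy `∫ |∇u|²`. -/
def energy (g : SmoothMetric I M) (u : M → ℝ) : ℝ≥0∞ :=
  ∫⁻ x, ENNReal.ofReal (gradInner g u u x) ∂(volumeMeasure g)

lemma oscillation_chartBall_le [CompactSpace M] (g : SmoothMetric I M) {c : M} {r : ℝ} {K : ℝ≥0∞}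
    (hK : K ≠ ⊤) (hdensity : ∀ y ∈ coordImage I c (chartBall I c r), density g c y ≤ K)
    {w : M → ℝ} (hw : Measurable[borel M] w) :
    oscillation (volumeMeasure g) w (chartBall I c r) (chartBall I c r) ≤
      K ^ 2 * oscillation volume (w ∘ (extChartAt I c).symm) (coordImage I c (chartBall I c r))
        (coordImage I c (chartBall I c r)) := by
  borelize M
  have hU := (isOpen_chartBall (I := I) c r).measurableSet
  refine (setLIntegral_volumeMeasure_le g hU inter_subset_left hK hdensity
    (measurable_setLIntegral_enorm_sub_sq _ hw _)).trans ?_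
  rw [pow_two, mul_assoc]
  refine mul_le_mul_right ?_ K
  rw [oscillation, ← lintegral_const_mul' K _ hK]
  refine lintegral_mono fun y ↦ ?_
  exact setLIntegral_volumeMeasure_le g hU inter_subset_left hK hdensity (by fun_prop)

lemma setLIntegral_chartFDeriv_le (g : SmoothMetric I M) {c : M} {r : ℝ} {m K : ℝ≥0∞}
    (hm : m ≠ 0) (hm_top : m ≠ ⊤) (hK : K ≠ ⊤)
    (hdensity : ∀ y ∈ coordImage I c (chartBall I c r), m ≤ density g c y)
    (hform : ∀ y ∈ coordImage I c (chartBall I c r), ‖coordForm g c y‖ₑ ≤ K)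
    (u : C^∞⟮I, M; 𝓘(ℝ, ℝ), ℝ⟯) :
    ∫⁻ y in coordImage I c (chartBall I c r), ‖chartFDeriv I u c y‖ₑ ^ 2 ≤
      K * m⁻¹ * energy g u := by
  borelize M
  have hU := (isOpen_chartBall (I := I) c r).measurableSet
  have henergy := (le_setLIntegral_volumeMeasure g hU inter_subset_left hdensity
    (continuous_gradInner g u u).measurable.ennreal_ofReal).trans (setLIntegral_le_lintegral _ _)
  rw [mul_comm, ← ENNReal.le_div_iff_mul_le (.inl hm) (.inl hm_top), ENNReal.div_eq_inv_mul]
    at henergy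
  rw [mul_assoc]
  refine le_trans ?_ (mul_le_mul_right henergy K)
  rw [← lintegral_const_mul' K _ hK]
  refine setLIntegral_mono' (measurableSet_coordImage c hU) fun y hy ↦ ?_
  refine le_trans ?_ (mul_le_mul_left (hform y hy) _)
  rw [← ofReal_norm, ← ofReal_norm, ← ENNReal.ofReal_pow (norm_nonneg _),
    ← ENNReal.ofReal_mul (norm_nonneg _)]
  exact ENNReal.ofReal_le_ofReal (chartFDeriv_sq_le g u hy.1)

lemma oscillation_comp_symm_le (u : C^∞⟮I, M; 𝓘(ℝ, ℝ), ℝ⟯) {c : M} {r : ℝ}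
    (hball : coordImage I c (chartBall I c r) = Metric.ball (extChartAt I c c) r ∩ range I) :
    oscillation volume (u ∘ (extChartAt I c).symm) (coordImage I c (chartBall I c r))
        (coordImage I c (chartBall I c r)) ≤
      ENNReal.ofReal (r + r) ^ 2 * (2 ^ n * volume (coordImage I c (chartBall I c r))) *
        ∫⁻ y in coordImage I c (chartBall I c r), ‖chartFDeriv I u c y‖ₑ ^ 2 := by
  have hdiam (y) (hy : y ∈ coordImage I c (chartBall I c r)) (z)
      (hz : z ∈ coordImage I c (chartBall I c r)) : ‖y - z‖ₑ ≤ ENNReal.ofReal (r + r) := by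
    rw [hball] at hy hz
    rw [← ofReal_norm, ← dist_eq_norm]
    exact ENNReal.ofReal_le_ofReal ((dist_triangle_right y z (extChartAt I c c)).trans
      (add_le_add (Metric.mem_ball.1 hy.1).le (Metric.mem_ball.1 hz.1).le))
  have hconvex : Convex ℝ (coordImage I c (chartBall I c r)) :=
    hball ▸ (convex_ball _ _).inter I.convex_range
  have hmeas : MeasurableSet (coordImage I c (chartBall I c r)) :=
    hball ▸ measurableSet_ball.inter I.isClosed_range.measurableSet
  have hle := oscillation_le_of_convex volume hconvex hmeas ENNReal.ofReal_ne_top hdiam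
    (fun y hy ↦ ((contDiffWithinAt_comp_symm u hy.1).differentiableWithinAt
      (by simp)).hasFDerivWithinAt.mono fun z hz ↦ extChartAt_target_subset_range _ hz.1)
    ((continuousOn_chartFDeriv u c).mono inter_subset_left)
  rwa [finrank_euclideanSpace_fin] at hle

lemma exists_nhds_hasPoincareBound [CompactSpace M] (g : SmoothMetric I M) (c : M) :
    ∃ U ∈ 𝓝 c, HasPoincareBound (volumeMeasure g)
      (fun (u : C^∞⟮I, M; 𝓘(ℝ, ℝ), ℝ⟯) ↦ u) (fun u ↦ energy g u) U U := by
  obtain ⟨r, hr, hball, m, K, hm, hK, h⟩ := exists_chartBall_bounds g c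
  have hm_top : m ≠ ⊤ := by
    have hc : extChartAt I c c ∈ coordImage I c (chartBall I c r) := mem_of_mem_nhdsWithin
      (extChartAt_target_subset_range _ (mem_extChartAt_target c))
      (coordImage_mem_nhdsWithin c (chartBall_mem_nhds c hr))
    exact ne_top_of_le_ne_top hK ((h _ hc).1.trans (h _ hc).2.1)
  have hvolume : volume (coordImage I c (chartBall I c r)) < ⊤ :=
    hball ▸ (measure_mono inter_subset_left).trans_lt measure_ball_lt_top
  set B := coordImage I c (chartBall I c r)
  refine ⟨chartBall I c r, chartBall_mem_nhds c hr, (K ^ 2 * (ENNReal.ofReal (r + r) ^ 2 *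
    (2 ^ n * volume B)) * (K * m⁻¹)).toNNReal, fun u ↦ ?_⟩
  rw [ENNReal.coe_toNNReal (by finiteness)]
  calc oscillation (volumeMeasure g) u (chartBall I c r) (chartBall I c r)
      ≤ K ^ 2 * oscillation volume (u ∘ (extChartAt I c).symm) B B :=
        oscillation_chartBall_le g hK (fun y hy ↦ (h y hy).2.1) (measurable_contMDiffMap u)
    _ ≤ K ^ 2 * (ENNReal.ofReal (r + r) ^ 2 * (2 ^ n * volume B) *
          ∫⁻ y in B, ‖chartFDeriv I u c y‖ₑ ^ 2) := by
        gcongr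
        exact oscillation_comp_symm_le u hball
    _ ≤ K ^ 2 * (ENNReal.ofReal (r + r) ^ 2 * (2 ^ n * volume B) *
          (K * m⁻¹ * energy g u)) := by
        gcongr
        exact setLIntegral_chartFDeriv_le g hm hm_top hK (fun y hy ↦ (h y hy).1)
          (fun y hy ↦ (h y hy).2.2) u
    _ = _ := by ring

end Poincare

section SpectralGap

lemma oscillation_univ_eq {X : Type*} {_ : MeasurableSpace X} (μ : Measure X) [IsFiniteMeasure μ]
    {w : X → ℝ} (hw : Integrable w μ) (hw_sq : Integrable (fun x ↦ w x ^ 2) μ) :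
    oscillation μ w univ univ = ENNReal.ofReal
      (2 * (μ.real univ * ∫ x, w x ^ 2 ∂μ - (∫ x, w x ∂μ) ^ 2)) := by
  have hexpand (p : X × X) : (w p.1 - w p.2) ^ 2 =
      w p.1 ^ 2 * 1 - 2 * (w p.1 * w p.2) + 1 * w p.2 ^ 2 := by ring
  have hleft : Integrable (fun p : X × X ↦ w p.1 ^ 2 * 1) (μ.prod μ) :=
    hw_sq.mul_prod (integrable_const 1)
  have hmixed : Integrable (fun p : X × X ↦ 2 * (w p.1 * w p.2)) (μ.prod μ) :=
    (hw.mul_prod hw).const_mul 2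
  have hright : Integrable (fun p : X × X ↦ 1 * w p.2 ^ 2) (μ.prod μ) :=
    (integrable_const 1).mul_prod hw_sq
  have hdiff : Integrable (fun p : X × X ↦ w p.1 ^ 2 * 1 - 2 * (w p.1 * w p.2)) (μ.prod μ) :=
    hleft.sub hmixed
  have hsq : Integrable (fun p : X × X ↦ (w p.1 - w p.2) ^ 2) (μ.prod μ) := by
    simp_rw [hexpand]
    exact hdiff.add hright
  have henorm (p : X × X) : ‖w p.1 - w p.2‖ₑ ^ 2 = ENNReal.ofReal ((w p.1 - w p.2) ^ 2) := by
    rw [← ofReal_norm, ← ENNReal.ofReal_pow (norm_nonneg _), Real.norm_eq_abs, sq_abs]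
  calc oscillation μ w univ univ
      = ∫⁻ p, ‖w p.1 - w p.2‖ₑ ^ 2 ∂(μ.prod μ) := by
        rw [oscillation, Measure.restrict_univ, lintegral_prod]
        simp_rw [henorm]
        exact hsq.aestronglyMeasurable.aemeasurable.ennreal_ofReal
    _ = ENNReal.ofReal (∫ p, (w p.1 - w p.2) ^ 2 ∂(μ.prod μ)) := by
        simp_rw [henorm]
        exact (ofReal_integral_eq_lintegral_ofReal hsq (ae_of_all _ fun p ↦ sq_nonneg _)).symm
    _ = _ := by
        simp_rw [hexpand]
        rw [integral_add hdiff hright, integral_sub hleft hmixed, integral_const_mul,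
          integral_prod_mul (fun x ↦ w x ^ 2) fun _ ↦ 1, integral_prod_mul w w,
          integral_prod_mul (fun _ ↦ 1) fun x ↦ w x ^ 2, integral_const, smul_eq_mul]
        ring_nf

lemma exists_eq_const_of_oscillation_eq_zero {X : Type*} [TopologicalSpace X] [Nonempty X]
    [MeasurableSpace X] [BorelSpace X] {μ : Measure X} [SFinite μ] [μ.IsOpenPosMeasure]
    {w : X → ℝ} (hw : Continuous w) (h : oscillation μ w univ univ = 0) :
    ∃ a, ∀ x, w x = a := by
  have : NeZero μ := ⟨fun hμ ↦ isOpen_univ.measure_ne_zero μ univ_nonempty (by simp [hμ])⟩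
  rw [oscillation, lintegral_eq_zero_iff (measurable_setLIntegral_enorm_sub_sq μ hw.measurable _),
    Measure.restrict_univ] at h
  obtain ⟨x, hx⟩ := h.exists
  refine ⟨w x, congrFun ((hw.ae_eq_iff_eq μ continuous_const).1 ?_)⟩
  rw [Pi.zero_apply, lintegral_eq_zero_iff (by fun_prop)] at hx
  filter_upwards [hx] with y hy
  exact (sub_eq_zero.1 (enorm_eq_zero.1 (pow_eq_zero_iff two_ne_zero |>.1 hy))).symm

variable {n : ℕ} {H : Type*} [TopologicalSpace H]
  {I : ModelWithCorners ℝ (EuclideanSpace ℝ (Fin n)) H}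
  {M : Type*} [TopologicalSpace M] [ChartedSpace H M]

lemma differential_const (r : ℝ) (x : M) : differential I (fun _ : M ↦ r) x = 0 :=
  mfderiv_const

variable [IsManifold I ∞ M] {g : SmoothMetric I M}

lemma gradInner_const (g : SmoothMetric I M) (u : M → ℝ) (r : ℝ) (x : M) :
    gradInner g u (fun _ ↦ r) x = 0 := by
  rw [gradInner_comm, gradInner_eq_differential, differential_const]
  rfl

lemma IsNeumannSolution.mul_integral_eq_zero {μ : ℝ} {u : C^∞⟮I, M; 𝓘(ℝ, ℝ), ℝ⟯}
    (h : IsNeumannSolution g μ u) : μ * ∫ x, u x ∂(volumeMeasure g) = 0 := by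
  have hone (x : M) : g.inner x (grad g u x) (grad g 1 x) = 0 := gradInner_const g u 1 x
  have htest := h 1
  simp only [ContMDiffMap.coe_one, Pi.one_apply, mul_one, hone, integral_zero] at htest
  exact htest.symm

variable [CompactSpace M]

lemma integrable_of_continuous (g : SmoothMetric I M) {f : M → ℝ} (hf : Continuous f) :
    Integrable f (volumeMeasure g) := by
  borelize M
  exact hf.integrable_of_hasCompactSupport (HasCompactSupport.of_compactSpace f)

lemma IsNeumannSolution.energy_eq {μ : ℝ} {u : C^∞⟮I, M; 𝓘(ℝ, ℝ), ℝ⟯}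
    (h : IsNeumannSolution g μ u) :
    energy g u = ENNReal.ofReal (μ * ∫ x, u x ^ 2 ∂(volumeMeasure g)) := by
  simp only [pow_two]
  rw [← h u]
  exact (ofReal_integral_eq_lintegral_ofReal
    (integrable_of_continuous g (continuous_gradInner g u u))
    (ae_of_all _ fun x ↦ gradInner_self_nonneg g u x)).symm

lemma IsNeumannSolution.oscillation_eq_zero {μ : ℝ} {u : C^∞⟮I, M; 𝓘(ℝ, ℝ), ℝ⟯}
    (h : IsNeumannSolution g μ u) {C : ℝ≥0}
    (hC : oscillation (volumeMeasure g) u univ univ ≤ C * energy g u)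
    (hμ : C * μ < 2 * (volumeMeasure g).real univ) :
    oscillation (volumeMeasure g) u univ univ = 0 := by
  borelize M
  have hu : Continuous u := u.contMDiff.continuous
  have hS : 0 ≤ ∫ x, u x ^ 2 ∂(volumeMeasure g) := integral_nonneg fun x ↦ sq_nonneg _
  rw [h.energy_eq] at hC
  rcases le_or_gt μ 0 with hμ₀ | hμ₀
  · rw [ENNReal.ofReal_of_nonpos (mul_nonpos_of_nonpos_of_nonneg hμ₀ hS), mul_zero] at hC
    exact le_antisymm hC zero_le
  have hmean := (mul_eq_zero.1 h.mul_integral_eq_zero).resolve_left hμ₀.ne'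
  have hosc := oscillation_univ_eq (volumeMeasure g) (integrable_of_continuous g hu)
    (integrable_of_continuous g (hu.pow 2))
  rw [hmean] at hosc
  rw [hosc, ← ENNReal.ofReal_coe_nnreal, ← ENNReal.ofReal_mul C.coe_nonneg,
    ENNReal.ofReal_le_ofReal_iff (by positivity)] at hC
  have hS_nonpos : ∫ x, u x ^ 2 ∂(volumeMeasure g) ≤ 0 := by
    by_contra! hpos
    linarith [mul_lt_mul_of_pos_right hμ hpos]
  rw [hosc, le_antisymm hS_nonpos hS]
  norm_num

theorem exists_spectralSpace_le_span_one [ConnectedSpace M] (g : SmoothMetric I M) :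
    ∃ L : ℝ≥0, 0 < L ∧ spectralSpace g L ≤ Submodule.span ℝ {1} := by
  borelize M
  obtain ⟨C, hC⟩ := HasPoincareBound.univ_of_local
    (measurable_contMDiffMap (I := I) (M := M)) (exists_nhds_hasPoincareBound g)
  have hV : 0 < (volumeMeasure g).real univ :=
    ENNReal.toReal_pos (isOpen_univ.measure_ne_zero _ univ_nonempty) (by finiteness)
  refine ⟨⟨(volumeMeasure g).real univ / (C + 1), by positivity⟩, div_pos hV (by positivity), ?_⟩
  refine Submodule.span_le.2 ?_
  rintro u ⟨μ, hμ, hu⟩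
  have hCμ : C * μ < 2 * (volumeMeasure g).real univ := by
    have hle : μ * (C + 1) ≤ (volumeMeasure g).real univ := (le_div_iff₀ (by positivity)).1 hμ
    rcases le_or_gt μ 0 with hμ₀ | hμ₀
    · nlinarith [mul_nonpos_of_nonneg_of_nonpos C.coe_nonneg hμ₀]
    · nlinarith
  obtain ⟨a, ha⟩ := exists_eq_const_of_oscillation_eq_zero u.contMDiff.continuous
    (hu.oscillation_eq_zero (hC u) hCμ)
  exact Submodule.mem_span_singleton.2 ⟨a, ContMDiffMap.ext fun x ↦ by simp [ha x]⟩

end SpectralGap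

section Sigma

variable {n : ℕ} {H : Type*} [TopologicalSpace H] [Nonempty H]
  {I : ModelWithCorners ℝ (EuclideanSpace ℝ (Fin n)) H}
  {ι : Type*} {M : ι → Type*} [∀ i, TopologicalSpace (M i)] [∀ i, ChartedSpace H (M i)]

omit [Nonempty H] [∀ i, ChartedSpace H (M i)] in
lemma measurableEmbedding_sigmaMk (i : ι) :
    @MeasurableEmbedding _ _ (borel (M i)) (borel (Σ i, M i)) (Sigma.mk i) := by
  borelize (M i)
  let : MeasurableSpace (Σ i, M i) := borel _
  have : BorelSpace (Σ i, M i) := ⟨rfl⟩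
  exact Topology.IsOpenEmbedding.sigmaMk.measurableEmbedding

lemma hasMFDerivAt_sigmaMk (i : ι) (x : M i) : HasMFDerivAt I I (Sigma.mk i : M i → Σ i, M i) x
    (ContinuousLinearMap.id ℝ (EuclideanSpace ℝ (Fin n))) := by
  refine ⟨continuous_sigmaMk.continuousAt, ?_⟩
  refine (hasFDerivWithinAt_id _ _).congr_of_eventuallyEq ?_ ?_
  · filter_upwards [extChartAt_target_mem_nhdsWithin (I := I) x] with y hy
    exact (extChartAt_sigma_apply i x _).trans ((extChartAt I x).right_inv hy)
  · exact (extChartAt_sigma_apply i x _).trans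
      ((extChartAt I x).right_inv (mem_extChartAt_target x))

lemma contMDiffAt_comp_sigmaMk {i : ι} {x : M i} {f : (Σ i, M i) → ℝ}
    (h : ContMDiffAt I 𝓘(ℝ, ℝ) ∞ f ⟨i, x⟩) : ContMDiffAt I 𝓘(ℝ, ℝ) ∞ (fun y ↦ f ⟨i, y⟩) x := by
  rw [contMDiffAt_iff, extChartAt_sigma_apply] at h
  exact contMDiffAt_iff.2 ⟨h.1.comp continuous_sigmaMk.continuousAt, h.2⟩

/-- Restriction to the summands, as an isomorphism `C^∞(⊔ᵢ Mᵢ) ≃ ∏ᵢ C^∞(Mᵢ)`. -/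
def restrictEquiv (I : ModelWithCorners ℝ (EuclideanSpace ℝ (Fin n)) H) (M : ι → Type*)
    [∀ i, TopologicalSpace (M i)] [∀ i, ChartedSpace H (M i)] :
    C^∞⟮I, Σ i, M i; 𝓘(ℝ, ℝ), ℝ⟯ ≃ₗ[ℝ] ∀ i, C^∞⟮I, M i; 𝓘(ℝ, ℝ), ℝ⟯ where
  toFun u i := ⟨fun x ↦ u ⟨i, x⟩, fun x ↦ contMDiffAt_comp_sigmaMk (u.contMDiff ⟨i, x⟩)⟩
  map_add' _ _ := rfl
  map_smul' _ _ := rfl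
  invFun f := ⟨fun p ↦ f p.1 p.2, fun p ↦ contMDiffAt_sigma ((f p.1).contMDiff p.2)⟩
  left_inv _ := rfl
  right_inv _ := rfl

lemma differential_sigma (u : C^∞⟮I, Σ i, M i; 𝓘(ℝ, ℝ), ℝ⟯) (i : ι) (x : M i) :
    differential I u ⟨i, x⟩ = differential I (restrictEquiv I M u i) x :=
  ((mdifferentiableAt_smooth u ⟨i, x⟩).hasMFDerivAt.comp x
    (hasMFDerivAt_sigmaMk i x)).mfderiv.symm

variable [∀ i, IsManifold I ∞ (M i)]

lemma coordDeriv_sigma (i : ι) (x : M i) {y : EuclideanSpace ℝ (Fin n)}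
    (hy : y ∈ (extChartAt I x).target) :
    coordDeriv I (⟨i, x⟩ : Σ i, M i) y = coordDeriv I x y := by
  have hx := (extChartAt I x).map_target hy
  have h := coordDeriv_extChartAt (I := I) (c := (⟨i, x⟩ : Σ i, M i))
    (x := ⟨i, (extChartAt I x).symm y⟩) ((extChartAt I (⟨i, x⟩ : Σ i, M i)).map_target hy)
  rw [extChartAt_sigma_apply, (extChartAt I x).right_inv hy] at h
  refine h.trans ((tangentCoordChange_sigma i _ _ _).trans ?_)
  rw [← coordDeriv_extChartAt hx, (extChartAt I x).right_inv hy]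

lemma density_sigma (g : ∀ i, SmoothMetric I (M i)) (i : ι) (x : M i)
    {y : EuclideanSpace ℝ (Fin n)} (hy : y ∈ (extChartAt I x).target) :
    density (sigmaMetric g) ⟨i, x⟩ y = density (g i) x y := by
  unfold density
  rw [metricCoeff_eq_toMatrix, metricCoeff_eq_toMatrix]
  congr 4
  unfold coordForm
  rw [coordDeriv_sigma i x hy]
  rfl

lemma chartVolume_sigma (g : ∀ i, SmoothMetric I (M i)) (i : ι) (x : M i) :
    chartVolume (sigmaMetric g) ⟨i, x⟩ =
      @Measure.map _ _ (borel (M i)) (borel (Σ i, M i)) (Sigma.mk i) (chartVolume (g i) x) := by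
  let : MeasurableSpace (M i) := borel _
  let : MeasurableSpace (Σ i, M i) := borel _
  refine Measure.ext fun A hA ↦ ?_
  have hA' := (measurableEmbedding_sigmaMk i).measurable hA
  rw [(measurableEmbedding_sigmaMk i).map_apply, chartVolume_apply _ _ hA,
    chartVolume_apply _ _ hA']
  exact setLIntegral_congr_fun (measurableSet_coordImage x hA') fun y hy ↦ density_sigma g i x hy.1

lemma volumeMeasure_le_comap_sigmaMk (g : ∀ i, SmoothMetric I (M i)) (i : ι) :
    volumeMeasure (g i) ≤
      @Measure.comap _ _ (borel (M i)) (borel (Σ i, M i)) (Sigma.mk i)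
        (volumeMeasure (sigmaMetric g)) := by
  refine iSup_le fun x ↦ ?_
  rw [← (measurableEmbedding_sigmaMk i).comap_map (chartVolume (g i) x), ← chartVolume_sigma]
  refine @Measure.le_intro _ (borel _) _ _ fun A _ _ ↦ ?_
  rw [(measurableEmbedding_sigmaMk i).comap_apply, (measurableEmbedding_sigmaMk i).comap_apply]
  exact le_iSup (chartVolume (sigmaMetric g)) _ _

lemma volumeMeasure_sigma [Countable ι] (g : ∀ i, SmoothMetric I (M i)) :
    volumeMeasure (sigmaMetric g) = @Measure.sum _ ι (borel _) fun i ↦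
      @Measure.map _ _ (borel (M i)) (borel (Σ i, M i)) (Sigma.mk i) (volumeMeasure (g i)) := by
  let := fun i ↦ borel (M i)
  let : MeasurableSpace (Σ i, M i) := borel _
  have hmk (i : ι) : MeasurableEmbedding (Sigma.mk i : M i → Σ i, M i) :=
    measurableEmbedding_sigmaMk i
  have hdisj : Pairwise (Function.onFun Disjoint fun i ↦ range (Sigma.mk i : M i → Σ i, M i)) :=
    fun i j hij ↦ disjoint_left.2 <| by
      rintro _ ⟨x, rfl⟩ ⟨y, hy⟩
      exact hij (congrArg Sigma.fst hy).symm
  refine le_antisymm (iSup_le ?_) ?_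
  · rintro ⟨i, x⟩
    rw [chartVolume_sigma]
    exact (Measure.map_mono (le_iSup (chartVolume (g i)) x) (hmk i).measurable).trans
      (Measure.le_sum (fun i ↦ (volumeMeasure (g i)).map (Sigma.mk i)) i)
  · calc Measure.sum (fun i ↦ (volumeMeasure (g i)).map (Sigma.mk i))
        ≤ Measure.sum fun i ↦ (volumeMeasure (sigmaMetric g)).restrict (range (Sigma.mk i)) := by
          refine Measure.le_iff.2 fun A hA ↦ ?_
          rw [Measure.sum_apply _ hA, Measure.sum_apply _ hA]
          gcongr with i
          rw [← (hmk i).map_comap]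
          exact Measure.map_mono (volumeMeasure_le_comap_sigmaMk g i) (hmk i).measurable
      _ = (volumeMeasure (sigmaMetric g)).restrict (⋃ i, range (Sigma.mk i)) :=
          (Measure.restrict_iUnion hdisj fun i ↦ (hmk i).measurableSet_range).symm
      _ ≤ volumeMeasure (sigmaMetric g) := Measure.restrict_le_self

lemma gradInner_sigma (g : ∀ i, SmoothMetric I (M i)) (u φ : C^∞⟮I, Σ i, M i; 𝓘(ℝ, ℝ), ℝ⟯)
    (i : ι) (x : M i) :
    gradInner (sigmaMetric g) u φ ⟨i, x⟩ =
      gradInner (g i) (restrictEquiv I M u i) (restrictEquiv I M φ i) x := by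
  unfold gradInner grad
  rw [differential_sigma, differential_sigma]
  rfl

omit [Nonempty H] in
lemma isNeumannSolution_zero {X : Type*} [TopologicalSpace X] [ChartedSpace H X]
    [IsManifold I ∞ X] (g : SmoothMetric I X) (μ : ℝ) : IsNeumannSolution g μ 0 := by
  intro φ
  have hzero (x : X) : g.inner x (grad g 0 x) (grad g φ x) = 0 :=
    (gradInner_comm g 0 φ x).trans (gradInner_const g φ 0 x)
  simp only [ContMDiffMap.coe_zero, hzero, Pi.zero_apply, zero_mul, integral_zero, mul_zero]

variable [Fintype ι]

lemma vol_sigma (g : ∀ i, SmoothMetric I (M i)) : vol (sigmaMetric g) = ∑ i, vol (g i) := by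
  rw [vol, volumeMeasure_sigma, Measure.sum_fintype, Measure.finsetSum_apply]
  exact Finset.sum_congr rfl fun i _ ↦ (measurableEmbedding_sigmaMk i).map_apply _ _

variable [∀ i, CompactSpace (M i)]

lemma integral_sigma (g : ∀ i, SmoothMetric I (M i)) {f : (Σ i, M i) → ℝ}
    (hf : ∀ i, Continuous fun x : M i ↦ f ⟨i, x⟩) :
    ∫ p, f p ∂(volumeMeasure (sigmaMetric g)) = ∑ i, ∫ x, f ⟨i, x⟩ ∂(volumeMeasure (g i)) := by
  let : MeasurableSpace (Σ i, M i) := borel _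
  rw [volumeMeasure_sigma, Measure.sum_fintype, integral_finsetSum_measure fun i _ ↦
    (measurableEmbedding_sigmaMk i).integrable_map_iff.2 (integrable_of_continuous (g i) (hf i))]
  exact Finset.sum_congr rfl fun i _ ↦ (measurableEmbedding_sigmaMk i).integral_map _

lemma integral_gradInner_sigma (g : ∀ i, SmoothMetric I (M i))
    (u φ : C^∞⟮I, Σ i, M i; 𝓘(ℝ, ℝ), ℝ⟯) :
    ∫ p, gradInner (sigmaMetric g) u φ p ∂(volumeMeasure (sigmaMetric g)) =
      ∑ i, ∫ x, gradInner (g i) (restrictEquiv I M u i) (restrictEquiv I M φ i) x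
        ∂(volumeMeasure (g i)) := by
  rw [integral_sigma g]
  · simp only [gradInner_sigma]
  · intro i
    simp only [gradInner_sigma]
    exact continuous_gradInner _ _ _

lemma integral_mul_sigma (g : ∀ i, SmoothMetric I (M i)) (u φ : C^∞⟮I, Σ i, M i; 𝓘(ℝ, ℝ), ℝ⟯) :
    ∫ p, u p * φ p ∂(volumeMeasure (sigmaMetric g)) =
      ∑ i, ∫ x, restrictEquiv I M u i x * restrictEquiv I M φ i x ∂(volumeMeasure (g i)) :=
  integral_sigma g fun i ↦ (restrictEquiv I M u i).contMDiff.continuous.mul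
    (restrictEquiv I M φ i).contMDiff.continuous

omit [Fintype ι] in
lemma isNeumannSolution_sigma_iff [Finite ι] (g : ∀ i, SmoothMetric I (M i)) (μ : ℝ)
    (u : C^∞⟮I, Σ i, M i; 𝓘(ℝ, ℝ), ℝ⟯) :
    IsNeumannSolution (sigmaMetric g) μ u ↔
      ∀ i, IsNeumannSolution (g i) μ (restrictEquiv I M u i) := by
  classical
  cases nonempty_fintype ι
  refine ⟨fun h i φ ↦ ?_, fun h φ ↦ ?_⟩
  · have htest := (integral_gradInner_sigma g u _).symm.trans
      (h ((restrictEquiv I M).symm (Pi.single i φ)))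
    rw [integral_mul_sigma, LinearEquiv.apply_symm_apply,
      Finset.sum_eq_single i, Finset.sum_eq_single i, Pi.single_eq_same] at htest
    · exact htest
    · intro j _ hj
      simp [Pi.single_eq_of_ne hj]
    · simp
    · intro j _ hj
      simp only [Pi.single_eq_of_ne hj, ContMDiffMap.coe_zero]
      exact (integral_congr_ae (ae_of_all _ (gradInner_const _ _ 0))).trans (integral_zero' _ _)
    · simp
  · rw [integral_mul_sigma, Finset.mul_sum]
    exact (integral_gradInner_sigma g u φ).trans (Finset.sum_congr rfl fun i _ ↦ h i _)

omit [Fintype ι] in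
lemma map_spectralSpace_sigma [Finite ι] (g : ∀ i, SmoothMetric I (M i)) (L : ℝ) :
    (spectralSpace (sigmaMetric g) L).map (restrictEquiv I M).toLinearMap =
      Submodule.pi univ fun i ↦ spectralSpace (g i) L := by
  classical
  cases nonempty_fintype ι
  refine le_antisymm ?_ fun f hf ↦ ?_
  · refine Submodule.map_le_iff_le_comap.2 (Submodule.span_le.2 ?_)
    rintro u ⟨μ, hμ, hu⟩ i -
    exact Submodule.subset_span ⟨μ, hμ, (isNeumannSolution_sigma_iff g μ u).1 hu i⟩
  · rw [← Finset.univ_sum_single f]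
    refine Submodule.sum_mem _ fun i _ ↦ ?_
    suffices spectralSpace (g i) L ≤ ((spectralSpace (sigmaMetric g) L).map
        (restrictEquiv I M).toLinearMap).comap (LinearMap.single ℝ _ i) from this (hf i trivial)
    refine Submodule.span_le.2 ?_
    rintro v ⟨μ, hμ, hv⟩
    refine ⟨(restrictEquiv I M).symm (Pi.single i v), Submodule.subset_span ⟨μ, hμ, ?_⟩,
      LinearEquiv.apply_symm_apply _ _⟩
    rw [isNeumannSolution_sigma_iff, LinearEquiv.apply_symm_apply]
    intro j
    rcases eq_or_ne j i with rfl | hj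
    · rwa [Pi.single_eq_same]
    · rw [Pi.single_eq_of_ne hj]
      exact isNeumannSolution_zero _ _

end Sigma

section Counting

variable {n : ℕ} {H : Type*} [TopologicalSpace H]
  {I : ModelWithCorners ℝ (EuclideanSpace ℝ (Fin n)) H}
  {M : Type*} [TopologicalSpace M] [ChartedSpace H M] [IsManifold I ∞ M]

lemma spectralSpace_mono (g : SmoothMetric I M) : Monotone (spectralSpace g) := by
  refine fun L L' hL ↦ Submodule.span_mono ?_
  rintro u ⟨μ, hμ, hu⟩
  exact ⟨μ, hμ.trans hL, hu⟩

/-- The number of eigenvalues in `[0, L]`, counted with multiplicity. -/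
def spectralCount (g : SmoothMetric I M) (L : ℝ) : ℕ∞ :=
  Module.length ℝ (spectralSpace g L)

lemma spectralCount_mono (g : SmoothMetric I M) : Monotone (spectralCount g) :=
  fun _ _ hL ↦ Module.length_le_of_injective _
    (Submodule.inclusion_injective (spectralSpace_mono g hL))

lemma isNeumannSolution_one (g : SmoothMetric I M) : IsNeumannSolution g 0 1 := by
  intro φ
  have hone (x : M) : g.inner x (grad g 1 x) (grad g φ x) = 0 :=
    (gradInner_comm g 1 φ x).trans (gradInner_const g φ 1 x)
  simp only [ContMDiffMap.coe_one, hone, integral_zero, zero_mul]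

lemma one_le_spectralCount [Nonempty M] (g : SmoothMetric I M) {L : ℝ} (hL : 0 ≤ L) :
    1 ≤ spectralCount g L := by
  have : Nontrivial (spectralSpace g L) :=
    nontrivial_of_ne ⟨1, Submodule.subset_span ⟨0, hL, isNeumannSolution_one g⟩⟩ 0 fun h ↦
      one_ne_zero (DFunLike.congr_fun (congrArg Subtype.val h) (Classical.arbitrary M))
  exact Order.one_le_iff_pos.2 Module.length_pos

/-- The number of eigenvalues in `[0, t)`, counted with multiplicity. -/
def eigenvalueCount (g : SmoothMetric I M) (t : ℝ≥0∞) : ℕ∞ :=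
  ⨆ L : {L : ℝ≥0 // (L : ℝ≥0∞) < t}, spectralCount g (L : ℝ≥0)

lemma eigenvalueCount_coe_le (g : SmoothMetric I M) (L : ℝ≥0) :
    eigenvalueCount g L ≤ spectralCount g L :=
  iSup_le fun L' ↦ spectralCount_mono g (NNReal.coe_le_coe.2 (ENNReal.coe_le_coe.1 L'.2.le))

lemma one_le_eigenvalueCount [Nonempty M] (g : SmoothMetric I M) {t : ℝ≥0∞} (ht : 0 < t) :
    1 ≤ eigenvalueCount g t :=
  (one_le_spectralCount g le_rfl).trans
    (le_iSup (fun L : {L : ℝ≥0 // (L : ℝ≥0∞) < t} ↦ spectralCount g (L : ℝ≥0)) ⟨0, ht⟩)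

theorem le_eigenvalue_iff (g : SmoothMetric I M) {k : ℕ} {t : ℝ≥0∞} :
    t ≤ eigenvalue g k ↔ eigenvalueCount g t ≤ k := by
  rw [eigenvalue, eigenvalueCount, le_iInf₂_iff, iSup_le_iff, Subtype.forall]
  refine forall_congr' fun L ↦ ?_
  rw [← not_imp_not, not_le, ← Cardinal.natCast_le_toENat, ← Module.length_eq_rank, not_le,
    Nat.cast_succ]
  exact imp_congr_right fun _ ↦ ENat.lt_add_one_iff (ENat.natCast_ne_top k)

theorem eigenvalue_pos [CompactSpace M] [ConnectedSpace M] (g : SmoothMetric I M) {k : ℕ}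
    (hk : 0 < k) : 0 < eigenvalue g k := by
  obtain ⟨L, hL, hspan⟩ := exists_spectralSpace_le_span_one g
  have hone : spectralCount g L ≤ 1 := by
    refine (Module.length_le_of_injective _ (Submodule.inclusion_injective hspan)).trans ?_
    rw [Module.length_eq_rank]
    exact Cardinal.toENat_le_one.2 ((rank_span_le _).trans (Cardinal.mk_singleton _).le)
  refine (ENNReal.coe_pos.2 hL).trans_le ((le_eigenvalue_iff g).2 ?_)
  exact (eigenvalueCount_coe_le g L).trans (hone.trans (Nat.one_le_cast.2 hk))

end Counting

section SigmaCounting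

lemma length_pi_univ {R : Type*} [Ring R] {ι : Type*} [Fintype ι] {V : ι → Type*}
    [∀ i, AddCommGroup (V i)] [∀ i, Module R (V i)] (S : ∀ i, Submodule R (V i)) :
    Module.length R (Submodule.pi univ S) = ∑ i, Module.length R (S i) := by
  let f : (∀ i, S i) →ₗ[R] ∀ i, V i := LinearMap.pi fun i ↦ (S i).subtype ∘ₗ LinearMap.proj i
  have hf : Function.Injective f := fun a b h ↦ funext fun i ↦ Subtype.ext (congrFun h i)
  have hrange : LinearMap.range f = Submodule.pi univ S := by
    ext a
    refine ⟨?_, fun ha ↦ ⟨fun i ↦ ⟨a i, ha i trivial⟩, rfl⟩⟩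
    rintro ⟨b, rfl⟩ i -
    exact (b i).2
  rw [← Module.length_pi_of_fintype, ← hrange]
  exact (LinearEquiv.ofInjective f hf).length_eq.symm

variable {n : ℕ} {H : Type*} [TopologicalSpace H] [Nonempty H]
  {I : ModelWithCorners ℝ (EuclideanSpace ℝ (Fin n)) H}
  {ι : Type*} [Fintype ι] {M : ι → Type*} [∀ i, TopologicalSpace (M i)]
  [∀ i, ChartedSpace H (M i)] [∀ i, IsManifold I ∞ (M i)] [∀ i, CompactSpace (M i)]

lemma spectralCount_sigma (g : ∀ i, SmoothMetric I (M i)) (L : ℝ) :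
    spectralCount (sigmaMetric g) L = ∑ i, spectralCount (g i) L := by
  unfold spectralCount
  rw [← length_pi_univ, ← map_spectralSpace_sigma]
  exact ((restrictEquiv I M).submoduleMap _).length_eq

theorem eigenvalueCount_sigma (g : ∀ i, SmoothMetric I (M i)) (t : ℝ≥0∞) :
    eigenvalueCount (sigmaMetric g) t = ∑ i, eigenvalueCount (g i) t := by
  simp only [eigenvalueCount, spectralCount_sigma]
  exact (ENat.sum_iSup_of_monotone fun i (L L' : {L : ℝ≥0 // (L : ℝ≥0∞) < t}) (hL : L ≤ L') ↦
    spectralCount_mono (g i) (NNReal.coe_le_coe.2 hL)).symm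

end SigmaCounting

section Homothety

variable {n : ℕ} {H : Type*} [TopologicalSpace H]
  {I : ModelWithCorners ℝ (EuclideanSpace ℝ (Fin n)) H}
  {M : Type*} [TopologicalSpace M] [ChartedSpace H M] [IsManifold I ∞ M]
  {g h : SmoothMetric I M} {r : ℝ≥0}

lemma density_homothetic (hgh : ∀ x v w, h.inner x v w = r * g.inner x v w) (c : M)
    (y : EuclideanSpace ℝ (Fin n)) : density h c y = r ^ (n / 2 : ℝ) * density g c y := by
  have hsmul : metricCoeff h c y = (r : ℝ) • metricCoeff g c y := by
    ext i j
    exact hgh _ _ _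
  have hsqrt : Real.sqrt ((r : ℝ) ^ n) = (r : ℝ) ^ (n / 2 : ℝ) := by
    rw [Real.sqrt_eq_rpow, ← Real.rpow_natCast, ← Real.rpow_mul r.coe_nonneg, mul_one_div]
  rw [density, hsmul, Matrix.det_smul, Fintype.card_fin, Real.sqrt_mul (by positivity), hsqrt,
    ENNReal.ofReal_mul (by positivity), density,
    ← ENNReal.ofReal_rpow_of_nonneg r.coe_nonneg (by positivity), ENNReal.ofReal_coe_nnreal]

lemma chartVolume_homothetic (hgh : ∀ x v w, h.inner x v w = r * g.inner x v w) (c : M) :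
    chartVolume h c = (r : ℝ≥0∞) ^ (n / 2 : ℝ) • chartVolume g c := by
  borelize M
  refine Measure.ext fun A hA ↦ ?_
  rw [Measure.smul_apply, chartVolume_apply _ _ hA, chartVolume_apply _ _ hA, smul_eq_mul,
    ← lintegral_const_mul' _ _ (by finiteness)]
  simp only [density_homothetic hgh]

lemma volumeMeasure_le_of_homothetic (hgh : ∀ x v w, h.inner x v w = r * g.inner x v w) :
    volumeMeasure h ≤ (r : ℝ≥0∞) ^ (n / 2 : ℝ) • volumeMeasure g := by
  borelize M
  refine iSup_le fun c ↦ ?_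
  rw [chartVolume_homothetic hgh]
  gcongr
  exact le_iSup (chartVolume g) c

variable (hr : r ≠ 0) (hgh : ∀ x v w, h.inner x v w = r * g.inner x v w)
include hr hgh

lemma volumeMeasure_homothetic :
    volumeMeasure h = (r : ℝ≥0∞) ^ (n / 2 : ℝ) • volumeMeasure g := by
  borelize M
  have hr' : (r : ℝ≥0∞) ≠ 0 := ENNReal.coe_ne_zero.2 hr
  have hinv : volumeMeasure g ≤ ((r : ℝ≥0∞)⁻¹) ^ (n / 2 : ℝ) • volumeMeasure h := by
    rw [← ENNReal.coe_inv hr]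
    refine volumeMeasure_le_of_homothetic fun x v w ↦ ?_
    rw [hgh, NNReal.coe_inv, inv_mul_cancel_left₀ (NNReal.coe_ne_zero.2 hr)]
  refine le_antisymm (volumeMeasure_le_of_homothetic hgh) ?_
  calc (r : ℝ≥0∞) ^ (n / 2 : ℝ) • volumeMeasure g
      ≤ (r : ℝ≥0∞) ^ (n / 2 : ℝ) • ((r : ℝ≥0∞)⁻¹) ^ (n / 2 : ℝ) • volumeMeasure h := by gcongr
    _ = volumeMeasure h := by
      rw [smul_smul, ← ENNReal.mul_rpow_of_nonneg _ _ (by positivity),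
        ENNReal.mul_inv_cancel hr' ENNReal.coe_ne_top, ENNReal.one_rpow, one_smul]

lemma vol_homothetic : vol h = (r : ℝ≥0∞) ^ (n / 2 : ℝ) * vol g := by
  rw [vol, volumeMeasure_homothetic hr hgh, Measure.smul_apply, smul_eq_mul, vol]

omit hr in
lemma inner_grad_homothetic (u : M → ℝ) (x : M) (v : TangentSpace I x) :
    r * g.inner x (grad h u x) v = g.inner x (grad g u x) v := by
  rw [← hgh, inner_grad, inner_grad]

lemma gradInner_homothetic (u φ : M → ℝ) (x : M) :
    gradInner h u φ x = (r : ℝ)⁻¹ * gradInner g u φ x := by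
  rw [gradInner_eq_differential, ← inner_grad g, g.symm, gradInner_comm, gradInner,
    ← inner_grad_homothetic hgh φ, inv_mul_cancel_left₀ (NNReal.coe_ne_zero.2 hr)]

lemma isNeumannSolution_homothetic_iff (μ : ℝ) (u : C^∞⟮I, M; 𝓘(ℝ, ℝ), ℝ⟯) :
    IsNeumannSolution h μ u ↔ IsNeumannSolution g (r * μ) u := by
  have hr' : (r : ℝ) ≠ 0 := NNReal.coe_ne_zero.2 hr
  have hc : ((r : ℝ≥0∞) ^ (n / 2 : ℝ)).toReal ≠ 0 := by
    rw [← ENNReal.toReal_rpow, ENNReal.coe_toReal]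
    positivity
  refine forall_congr' fun φ ↦ ?_
  change ∫ x, gradInner h u φ x ∂_ = _ ↔ ∫ x, gradInner g u φ x ∂_ = _
  simp only [gradInner_homothetic hr hgh, volumeMeasure_homothetic hr hgh, integral_smul_measure,
    integral_const_mul, smul_eq_mul]
  rw [mul_left_comm μ, mul_left_comm (r : ℝ)⁻¹, mul_right_inj' hc,
    inv_mul_eq_iff_eq_mul₀ hr', mul_assoc]

lemma spectralSpace_homothetic (L : ℝ) : spectralSpace h L = spectralSpace g (r * L) := by
  have hr' : 0 < (r : ℝ) := NNReal.coe_pos.2 (pos_iff_ne_zero.2 hr)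
  refine congrArg (Submodule.span ℝ) (Set.ext fun u ↦ ⟨?_, ?_⟩)
  · rintro ⟨μ, hμ, hu⟩
    exact ⟨r * μ, by gcongr, (isNeumannSolution_homothetic_iff hr hgh μ u).1 hu⟩
  · rintro ⟨μ, hμ, hu⟩
    refine ⟨μ / r, (div_le_iff₀' hr').2 hμ, (isNeumannSolution_homothetic_iff hr hgh _ u).2 ?_⟩
    rwa [mul_div_cancel₀ _ hr'.ne']

theorem eigenvalue_homothetic (k : ℕ) : eigenvalue g k = r * eigenvalue h k := by
  rw [eigenvalue, eigenvalue, ENNReal.mul_iInf_of_ne (ENNReal.coe_ne_zero.2 hr) ENNReal.coe_ne_top,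
    ← (Equiv.mulLeft₀ r hr).iInf_comp]
  refine iInf_congr fun L ↦ ?_
  rw [ENNReal.mul_iInf_of_ne (ENNReal.coe_ne_zero.2 hr) ENNReal.coe_ne_top,
    spectralSpace_homothetic hr hgh, Equiv.mulLeft₀_apply, NNReal.coe_mul, ENNReal.coe_mul]

end Homothety

section Conformal

variable {n : ℕ} {H : Type*} [TopologicalSpace H]
  {I : ModelWithCorners ℝ (EuclideanSpace ℝ (Fin n)) H}
  {M : Type*} [TopologicalSpace M] [ChartedSpace H M] [IsManifold I ∞ M]

/-- The conformal metric `e^{2f} g`. -/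
def conformalMetric (f : C^∞⟮I, M; 𝓘(ℝ, ℝ), ℝ⟯) (g : SmoothMetric I M) : SmoothMetric I M where
  inner x := Real.exp (2 * f x) • g.inner x
  symm x v w := by
    change Real.exp (2 * f x) * g.inner x v w = Real.exp (2 * f x) * g.inner x w v
    rw [g.symm]
  pos x v hv := mul_pos (Real.exp_pos _) (g.pos x v hv)
  isVonNBounded x := by
    refine ((g.isVonNBounded x).image
      (Real.exp (-f x) • ContinuousLinearMap.id ℝ (TangentSpace I x))).subset fun v hv ↦ ?_
    refine ⟨Real.exp (f x) • v, ?_, ?_⟩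
    · have hv' : Real.exp (2 * f x) * g.inner x v v < 1 := hv
      change g.inner x (Real.exp (f x) • v) (Real.exp (f x) • v) < 1
      rw [map_smul, map_smul]
      change Real.exp (f x) * (Real.exp (f x) * g.inner x v v) < 1
      rwa [← mul_assoc, ← Real.exp_add, ← two_mul]
    · change Real.exp (-f x) • Real.exp (f x) • v = v
      rw [smul_smul, ← Real.exp_add, neg_add_cancel, Real.exp_zero, one_smul]
  contMDiff := by
    have hf : ContMDiff I 𝓘(ℝ, ℝ) ∞ fun x ↦ Real.exp (2 * f x) :=
      Real.contDiff_exp.contMDiff.comp (contMDiff_const.mul f.contMDiff)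
    exact hf.smul_section g.contMDiff

lemma conformalMetric_mem_conformalClass (f : C^∞⟮I, M; 𝓘(ℝ, ℝ), ℝ⟯) (g : SmoothMetric I M) :
    conformalMetric f g ∈ conformalClass g :=
  ⟨f, fun _ _ _ ↦ rfl⟩

lemma self_mem_conformalClass (g : SmoothMetric I M) : g ∈ conformalClass g :=
  ⟨0, fun _ _ _ ↦ by simp⟩

lemma smoothMetric_ext {g h : SmoothMetric I M}
    (heq : ∀ x v w, g.inner x v w = h.inner x v w) : g = h := by
  have hinner : g.inner = h.inner := by
    ext x v w
    exact heq x v w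
  cases g
  cases h
  congr

lemma exists_homothetic_mem_conformalClass {g h : SmoothMetric I M} (hh : h ∈ conformalClass g)
    {r : ℝ≥0} (hr : r ≠ 0) :
    ∃ h' ∈ conformalClass g, ∀ x v w, h'.inner x v w = r * h.inner x v w := by
  obtain ⟨f, hf⟩ := hh
  let c : C^∞⟮I, M; 𝓘(ℝ, ℝ), ℝ⟯ := ⟨fun _ ↦ Real.log r / 2, contMDiff_const⟩
  refine ⟨conformalMetric (f + c) g, conformalMetric_mem_conformalClass _ _, fun x v w ↦ ?_⟩
  change Real.exp (2 * (f x + Real.log r / 2)) * g.inner x v w = _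
  rw [hf, mul_add, Real.exp_add, mul_div_cancel₀ _ two_ne_zero,
    Real.exp_log (NNReal.coe_pos.2 (pos_iff_ne_zero.2 hr)), ← mul_assoc, mul_comm (r : ℝ)]

lemma normalizedEigenvalue_rpow [NeZero n] (g : SmoothMetric I M) (k : ℕ) :
    normalizedEigenvalue g k ^ (n / 2 : ℝ) = eigenvalue g k ^ (n / 2 : ℝ) * vol g := by
  have hn : (n : ℝ) ≠ 0 := NeZero.ne _
  rw [normalizedEigenvalue, ENNReal.mul_rpow_of_nonneg _ _ (by positivity), ← ENNReal.rpow_mul,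
    div_mul_div_cancel₀ hn, div_self two_ne_zero, ENNReal.rpow_one]

/-- The metrics in the conformal class of `g` normalized by `λ_k ≥ 1`: maximizing `λ_k` at fixed
volume amounts to maximizing the volume among these. -/
def normalizedMetrics (g : SmoothMetric I M) (k : ℕ) : Set (SmoothMetric I M) :=
  {h ∈ conformalClass g | 1 ≤ eigenvalue h k}

lemma exists_mem_normalizedMetrics_vol_eq {g h : SmoothMetric I M} (hh : h ∈ conformalClass g)
    {k : ℕ} {r : ℝ≥0} (hr : r ≠ 0) (hrh : r ≤ eigenvalue h k) :
    ∃ h' ∈ normalizedMetrics g k, vol h' = (r : ℝ≥0∞) ^ (n / 2 : ℝ) * vol h := by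
  obtain ⟨h', hh', hscale⟩ := exists_homothetic_mem_conformalClass hh hr
  refine ⟨h', ⟨hh', ?_⟩, vol_homothetic hr hscale⟩
  rw [eigenvalue_homothetic hr hscale] at hrh
  refine (ENNReal.mul_le_mul_iff_right (ENNReal.coe_ne_zero.2 hr) ENNReal.coe_ne_top).1 ?_
  rwa [mul_one]

lemma normalizedMetrics_nonempty [CompactSpace M] [ConnectedSpace M] (g : SmoothMetric I M)
    {k : ℕ} (hk : 0 < k) : (normalizedMetrics g k).Nonempty := by
  obtain ⟨r, hr, hr'⟩ := ENNReal.lt_iff_exists_nnreal_btwn.1 (eigenvalue_pos g hk)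
  obtain ⟨h, hh, -⟩ := exists_mem_normalizedMetrics_vol_eq (self_mem_conformalClass g)
    (ENNReal.coe_pos.1 hr).ne' hr'.le
  exact ⟨h, hh⟩

theorem conformalEigenvalue_rpow [NeZero n] (g : SmoothMetric I M) (k : ℕ) :
    conformalEigenvalue g k ^ (n / 2 : ℝ) = ⨆ h ∈ normalizedMetrics g k, vol h := by
  have hn : 0 < (n / 2 : ℝ) := div_pos (Nat.cast_pos.2 (NeZero.pos n)) two_pos
  have hsup := (ENNReal.orderIsoRpow _ hn).map_iSup₂
    (fun (h : SmoothMetric I M) (_ : h ∈ conformalClass g) ↦ normalizedEigenvalue h k)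
  simp only [ENNReal.orderIsoRpow_apply, normalizedEigenvalue_rpow] at hsup
  refine hsup.trans (le_antisymm (iSup₂_le fun h hh ↦ ?_) (iSup₂_le fun h hh ↦ ?_))
  · refine ENNReal.mul_le_of_forall_lt fun a ha b hb ↦ ?_
    obtain ⟨r, har, hrh⟩ := ENNReal.lt_iff_exists_nnreal_btwn.1 ((ENNReal.rpow_inv_lt_iff hn).2 ha)
    obtain ⟨h', hh', hvol⟩ := exists_mem_normalizedMetrics_vol_eq hh
      (ENNReal.coe_pos.1 (zero_le.trans_lt har)).ne' hrh.le
    calc a * b ≤ (r : ℝ≥0∞) ^ (n / 2 : ℝ) * vol h :=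
          mul_le_mul' ((ENNReal.rpow_inv_lt_iff hn).1 har).le hb.le
      _ = vol h' := hvol.symm
      _ ≤ ⨆ h ∈ normalizedMetrics g k, vol h := le_iSup₂ (f := fun h _ ↦ vol h) h' hh'
  · exact (le_mul_of_one_le_left zero_le (ENNReal.one_le_rpow hh.2 hn)).trans
      (le_iSup₂ (f := fun (h : SmoothMetric I M) (_ : h ∈ conformalClass g) ↦
        eigenvalue h k ^ (n / 2 : ℝ) * vol h) h hh.1)

end Conformal

section FiniteSums

variable {ι : Type*} [Fintype ι]

lemma exists_sum_eq_of_sum_le [Nonempty ι] {N : ι → ℕ∞} {k : ℕ} (hN : ∑ i, N i ≤ k) :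
    ∃ κ : ι → ℕ, ∑ i, κ i = k ∧ ∀ i, N i ≤ κ i := by
  classical
  have htop (i : ι) : N i ≠ ⊤ :=
    ENat.sum_ne_top.1 (ne_top_of_le_ne_top (ENat.natCast_ne_top k) hN) i (Finset.mem_univ i)
  lift N to ι → ℕ using htop
  have hle : ∑ i, N i ≤ k := by simpa only [← Nat.cast_sum, Nat.cast_le] using hN
  refine ⟨N + Pi.single (Classical.arbitrary ι) (k - ∑ i, N i), ?_, fun i ↦ ?_⟩
  · simp only [Pi.add_apply, Finset.sum_add_distrib, Finset.sum_pi_single', Finset.mem_univ,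
      if_true]
    exact Nat.add_sub_of_le hle
  · exact Nat.cast_le.2 (Nat.le_add_right _ _)

lemma sum_biSup_le {X : ι → Type*} {S : ∀ i, Set (X i)} (hS : ∀ i, (S i).Nonempty)
    {F : ∀ i, X i → ℝ≥0∞} {b : ℝ≥0∞}
    (hb : ∀ x : ∀ i, X i, (∀ i, x i ∈ S i) → ∑ i, F i (x i) ≤ b) :
    ∑ i, ⨆ x ∈ S i, F i x ≤ b := by
  classical
  have : ∀ i, Nonempty (S i) := fun i ↦ (hS i).to_subtype
  have hpi (i : ι) : ⨆ x ∈ S i, F i x = ⨆ x : ∀ i, S i, F i (x i) :=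
    iSup_subtype'.trans (Function.Surjective.iSup_comp (f := fun x : ∀ i, S i ↦ x i)
      (Function.surjective_eval i) (fun x : S i ↦ F i x)).symm
  simp only [hpi]
  rw [ENNReal.finsetSum_iSup]
  · exact iSup_le fun x ↦ hb _ fun i ↦ (x i).2
  · intro x y
    refine ⟨fun i ↦ if F i (x i) ≤ F i (y i) then y i else x i, fun i ↦ ?_⟩
    dsimp only
    split_ifs with hi
    · exact ⟨hi, le_rfl⟩
    · exact ⟨le_rfl, (not_le.1 hi).le⟩

end FiniteSums

section DisjointUnion

variable {n : ℕ} {H : Type*} [TopologicalSpace H] [Nonempty H]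
  {I : ModelWithCorners ℝ (EuclideanSpace ℝ (Fin n)) H}
  {ι : Type*} {M : ι → Type*} [∀ i, TopologicalSpace (M i)]
  [∀ i, ChartedSpace H (M i)] [∀ i, IsManifold I ∞ (M i)]

theorem mem_conformalClass_sigma_iff (g : ∀ i, SmoothMetric I (M i))
    (h : SmoothMetric I (Σ i, M i)) :
    h ∈ conformalClass (sigmaMetric g) ↔
      ∃ h' : ∀ i, SmoothMetric I (M i), (∀ i, h' i ∈ conformalClass (g i)) ∧
        h = sigmaMetric h' := by
  constructor
  · rintro ⟨f, hf⟩
    exact ⟨fun i ↦ conformalMetric (restrictEquiv I M f i) (g i),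
      fun i ↦ conformalMetric_mem_conformalClass _ _, smoothMetric_ext fun p v w ↦ hf p v w⟩
  · rintro ⟨h', hh', rfl⟩
    choose f hf using hh'
    exact ⟨(restrictEquiv I M).symm f, fun p v w ↦ hf p.1 p.2 v w⟩

variable [Fintype ι] [∀ i, CompactSpace (M i)]

lemma sigmaMetric_mem_normalizedMetrics {g h : ∀ i, SmoothMetric I (M i)} {κ : ι → ℕ}
    (hh : ∀ i, h i ∈ normalizedMetrics (g i) (κ i)) :
    sigmaMetric h ∈ normalizedMetrics (sigmaMetric g) (∑ i, κ i) := by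
  refine ⟨(mem_conformalClass_sigma_iff g _).2 ⟨h, fun i ↦ (hh i).1, rfl⟩, ?_⟩
  rw [le_eigenvalue_iff, eigenvalueCount_sigma, Nat.cast_sum]
  exact Finset.sum_le_sum fun i _ ↦ (le_eigenvalue_iff (h i)).1 (hh i).2

lemma exists_normalizedMetrics_of_mem_sigma [Nonempty ι] [∀ i, Nonempty (M i)]
    {g : ∀ i, SmoothMetric I (M i)} {k : ℕ} {h : SmoothMetric I (Σ i, M i)}
    (hh : h ∈ normalizedMetrics (sigmaMetric g) k) :
    ∃ (κ : ι → ℕ) (h' : ∀ i, SmoothMetric I (M i)), (∀ i, 0 < κ i) ∧ ∑ i, κ i = k ∧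
      (∀ i, h' i ∈ normalizedMetrics (g i) (κ i)) ∧ h = sigmaMetric h' := by
  obtain ⟨h', hh', rfl⟩ := (mem_conformalClass_sigma_iff g h).1 hh.1
  have hcount := (le_eigenvalue_iff _).1 hh.2
  rw [eigenvalueCount_sigma] at hcount
  obtain ⟨κ, hsum, hκ⟩ := exists_sum_eq_of_sum_le hcount
  exact ⟨κ, h', fun i ↦ Nat.one_le_cast.1 ((one_le_eigenvalueCount (h' i) one_pos).trans (hκ i)),
    hsum, fun i ↦ ⟨hh' i, (le_eigenvalue_iff _).2 (hκ i)⟩, rfl⟩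

lemma eigenvalue_sigma_eq_zero [∀ i, Nonempty (M i)] (g : ∀ i, SmoothMetric I (M i)) {k : ℕ}
    (hk : k < Fintype.card ι) : eigenvalue (sigmaMetric g) k = 0 := by
  by_contra hne
  have hcount :=
    (le_eigenvalue_iff (sigmaMetric g) (k := k) (t := eigenvalue (sigmaMetric g) k)).1 le_rfl
  rw [eigenvalueCount_sigma] at hcount
  refine hk.not_ge (Nat.cast_le (α := ℕ∞).1 ?_)
  calc (Fintype.card ι : ℕ∞) = ∑ _i : ι, 1 := by simp
    _ ≤ ∑ i, eigenvalueCount (g i) (eigenvalue (sigmaMetric g) k) :=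
      Finset.sum_le_sum fun i _ ↦ one_le_eigenvalueCount (g i) (pos_iff_ne_zero.2 hne)
    _ ≤ k := hcount

theorem conformalEigenvalue_sigma_eq_zero [∀ i, Nonempty (M i)] (g : ∀ i, SmoothMetric I (M i))
    {k : ℕ} (hk : k < Fintype.card ι) : conformalEigenvalue (sigmaMetric g) k = 0 := by
  simp only [conformalEigenvalue, ENNReal.iSup_eq_zero]
  intro h hh
  obtain ⟨h', -, rfl⟩ := (mem_conformalClass_sigma_iff g h).1 hh
  rw [normalizedEigenvalue, eigenvalue_sigma_eq_zero h' hk, zero_mul]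

variable [NeZero n] [∀ i, ConnectedSpace (M i)]

theorem sum_conformalEigenvalue_rpow_le (g : ∀ i, SmoothMetric I (M i)) {κ : ι → ℕ}
    (hκ : ∀ i, 0 < κ i) :
    ∑ i, conformalEigenvalue (g i) (κ i) ^ (n / 2 : ℝ) ≤
      conformalEigenvalue (sigmaMetric g) (∑ i, κ i) ^ (n / 2 : ℝ) := by
  simp only [conformalEigenvalue_rpow]
  refine sum_biSup_le (fun i ↦ normalizedMetrics_nonempty (g i) (hκ i)) fun h hh ↦ ?_
  rw [← vol_sigma]
  exact le_iSup₂ (f := fun h _ ↦ vol h) _ (sigmaMetric_mem_normalizedMetrics hh)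

theorem exists_conformalEigenvalue_sigma_rpow_le [Nonempty ι] (g : ∀ i, SmoothMetric I (M i))
    {k : ℕ} (hk : Fintype.card ι ≤ k) :
    ∃ κ : ι → ℕ, (∀ i, 0 < κ i) ∧ ∑ i, κ i = k ∧
      conformalEigenvalue (sigmaMetric g) k ^ (n / 2 : ℝ) ≤
        ∑ i, conformalEigenvalue (g i) (κ i) ^ (n / 2 : ℝ) := by
  classical
  let T : Set (ι → ℕ) := {κ | (∀ i, 0 < κ i) ∧ ∑ i, κ i = k}
  have hfinite : T.Finite := (Finset.univ.piAntidiag k).finite_toSet.subset fun κ hκ ↦ by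
    simp [hκ.2]
  have hnonempty : T.Nonempty := by
    obtain ⟨κ, hsum, hκ⟩ := exists_sum_eq_of_sum_le (N := fun _ : ι ↦ 1) (k := k) (by simpa)
    exact ⟨κ, fun i ↦ Nat.one_le_cast.1 (hκ i), hsum⟩
  obtain ⟨κ, hκ, hmax⟩ := exists_max_image T
    (fun κ ↦ ∑ i, conformalEigenvalue (g i) (κ i) ^ (n / 2 : ℝ)) hfinite hnonempty
  refine ⟨κ, hκ.1, hκ.2, ?_⟩
  rw [conformalEigenvalue_rpow]
  refine iSup₂_le fun h hh ↦ ?_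
  obtain ⟨κ', h', hpos, hsum, hh', rfl⟩ := exists_normalizedMetrics_of_mem_sigma hh
  refine le_trans ?_ (hmax κ' ⟨hpos, hsum⟩)
  simp only [vol_sigma, conformalEigenvalue_rpow]
  exact Finset.sum_le_sum fun i _ ↦ le_iSup₂ (f := fun h _ ↦ vol h) (h' i) (hh' i)

end DisjointUnion

end ConformalSpectrum

end

theorem mainTheorem5_general {n : ℕ} [NeZero n] {H : Type*} [TopologicalSpace H] [Nonempty H]
    {I : ModelWithCorners ℝ (EuclideanSpace ℝ (Fin n)) H} {ι : Type*} [Fintype ι] [Nonempty ι]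
    {M : ι → Type*} [∀ i, TopologicalSpace (M i)] [∀ i, ChartedSpace H (M i)]
    [∀ i, IsManifold I ∞ (M i)] [∀ i, CompactSpace (M i)] [∀ i, ConnectedSpace (M i)]
    (g : ∀ i, SmoothMetric I (M i)) (k : ℕ) :
    (Fintype.card ι ≤ k → IsGreatest
      {t : ℝ≥0∞ | ∃ κ : ι → ℕ, (∀ i, 0 < κ i) ∧ ∑ i, κ i = k ∧
        t = ∑ i, conformalEigenvalue (g i) (κ i) ^ (n / 2 : ℝ)}
      (conformalEigenvalue (sigmaMetric g) k ^ (n / 2 : ℝ))) ∧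
    (k < Fintype.card ι → conformalEigenvalue (sigmaMetric g) k = 0) := by
  refine ⟨fun hk ↦ ⟨?_, ?_⟩, conformalEigenvalue_sigma_eq_zero g⟩
  · obtain ⟨κ, hκ, rfl, hle⟩ := exists_conformalEigenvalue_sigma_rpow_le g hk
    exact ⟨κ, hκ, rfl, hle.antisymm (sum_conformalEigenvalue_rpow_le g hκ)⟩
  · rintro _ ⟨κ, hκ, rfl, rfl⟩
    exact sum_conformalEigenvalue_rpow_le g hκ

theorem mainTheorem5 (n : ℕ) [NeZero n] (s : ℕ) (hs : 0 < s) (k : ℕ) (hk : 0 < k) :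
    -- compact manifolds with smooth boundary, Neumann eigenvalues
    (∀ (Ω : Fin s → Type*) [∀ i, TopologicalSpace (Ω i)]
        [∀ i, ChartedSpace (EuclideanHalfSpace n) (Ω i)] [∀ i, IsManifold (𝓡∂ n) ∞ (Ω i)]
        [∀ i, T2Space (Ω i)] [∀ i, CompactSpace (Ω i)] [∀ i, ConnectedSpace (Ω i)]
        (g : ∀ i, SmoothMetric (𝓡∂ n) (Ω i)),
      (s ≤ k → IsGreatest
        {t : ℝ≥0∞ | ∃ κ : Fin s → ℕ, (∀ i, 0 < κ i) ∧ ∑ i, κ i = k ∧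
          t = ∑ i, conformalEigenvalue (g i) (κ i) ^ (n / 2 : ℝ)}
        (conformalEigenvalue (sigmaMetric g) k ^ (n / 2 : ℝ))) ∧
      (k < s → conformalEigenvalue (sigmaMetric g) k = 0)) ∧
    -- closed manifolds
    (∀ (M : Fin s → Type*) [∀ i, TopologicalSpace (M i)]
        [∀ i, ChartedSpace (EuclideanSpace ℝ (Fin n)) (M i)] [∀ i, IsManifold (𝓡 n) ∞ (M i)]
        [∀ i, T2Space (M i)] [∀ i, CompactSpace (M i)] [∀ i, ConnectedSpace (M i)]
        (g : ∀ i, SmoothMetric (𝓡 n) (M i)),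
      (s ≤ k → IsGreatest
        {t : ℝ≥0∞ | ∃ κ : Fin s → ℕ, (∀ i, 0 < κ i) ∧ ∑ i, κ i = k ∧
          t = ∑ i, conformalEigenvalue (g i) (κ i) ^ (n / 2 : ℝ)}
        (conformalEigenvalue (sigmaMetric g) k ^ (n / 2 : ℝ))) ∧
      (k < s → conformalEigenvalue (sigmaMetric g) k = 0)) := by
  have : NeZero s := ⟨hs.ne'⟩
  constructor
  · intro Ω _ _ _ _ _ _ g
    simpa only [Fintype.card_fin] using mainTheorem5_general g k
  · intro M _ _ _ _ _ _ g
    simpa only [Fintype.card_fin] using mainTheorem5_general g k
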